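/- Let $K=\mathbb F_q$ be a finite field and let $\mathcal X,\mathcal Y$ be smooth projective absolutely irreducible curves over $K$. Let $g:\mathcal X\to\mathcal Y$ be a separable map of degree $r+1$, and let $x\in K(\mathcal X)$ satisfy $K(\mathcal X)=K(\mathcal Y)(x)$, with minimal equation $x^{r+1}+b_rx^r+\dots+b_0=0$, $b_i\in K(\mathcal Y)$. Let $h=[K(\mathcal X):K(x)]$ be the degree of $x$. For a divisor $G$ on a curve $\mathcal Z$ over $K$ write $\mathcal L(G)=\{f\in K(\mathcal Z)^*\mid (f)+G\ge 0\}\cup\{0\}$. Let $S=\{P_1,\dots,P_s\}\subset\mathcal Y(K)$ consist of $s$ distinct rational points such that $g^{-1}(S)$ consists of $n=(r+1)s$ distinct rational points $P_{ij}\in\mathcal X(K)$ ($0\le i\le r$, $1\le j\le s$) with $g(P_{ij})=P_j$. Let $Q_\infty$ be a divisor on $\mathcal Y$ of degree $\ell$ whose support is disjoint from $S$, and let $t\ge 0$ be an integer such that $D=tQ_\infty$ is effective. Assume that for each $1\le i\le r$ there is a natural number $n_i$ with $b_i\in\mathcal L(n_iQ_\infty)$, and that $x$ has no pole at any of the points $P_{ij}$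 (which is automatic if also $b_0\in\mathcal L(n_0Q_\infty)$ for some natural number $n_0$). Let $f_1,\dots,f_m$ be a basis of $\mathcal L(D)$, regarded as functions on $\mathcal X$ through $g$, and let $C\subseteq K^n$ be the linear code spanned by the vectors of values at the points $P_{ij}$ of the functions $f_jx^i$, $0\le i\le r-1$, $1\le j\le m$. For $1\le v\le\dim_K C$ let $d_v(C)$ be the $v$-th generalized Hamming weight of $C$, that is, the least number of elements of the support $\{\iota\mid c_\iota\ne 0\text{ for some }c\in\mathcal D\}$ of a $v$-dimensional linear subcode $\mathcal D\subseteq C$. For $i\ge1$ let $\gamma_{i,K}(\mathcal X)$ be the least degree of a divisor class $R$ on $\mathcal X$ defined over $K$ with $h^0(R)\ge i+1$. Then for every integer $v$ with $2\le v\le\dim_K C$, $$d_v(C)\ \ge\ n-t\ell(r+1)-(r-1)h+\gamma_{v-1,K}(\mathcal X).$$ -/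

import Mathlib

open scoped IntermediateField

noncomputable section

namespace AGCode

/-- `F` is the function field of a smooth projective absolutely irreducible curve over the
(perfect) field `K`: it is a finite extension of `K(z)` for some `z` transcendental over `K`, and
`K` is algebraically closed in `F`. Such curves and their dominant maps correspond
(contravariantly) to such fields and their `K`-embeddings. -/
structure IsCurveField (K F : Type*) [Field K] [Field F] [Algebra K F] : Prop where
  exists_transcendental : ∃ z : F, Transcendental K z ∧ FiniteDimensional K⟮z⟯ F
  constants : ∀ a : F, IsAlgebraic K a → ∃ c : K, algebraMap K F c = a

/-- A place of `F / K` (a closed point of the curve): a discrete valuation ring of `F` that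
contains `K`. -/
@[ext]
structure Place (K F : Type*) [Field K] [Field F] [Algebra K F] where
  ring : ValuationSubring F
  dvr : IsDiscreteValuationRing ring
  algebraMap_mem : ∀ c : K, algebraMap K F c ∈ ring

namespace Place

variable {K F : Type*} [Field K] [Field F] [Algebra K F] (P : Place K F)

instance : IsDiscreteValuationRing P.ring := P.dvr

instance : Algebra K P.ring :=
  ((algebraMap K F).codRestrict P.ring P.algebraMap_mem).toAlgebra

/-- The normalized valuation at `P`, written multiplicatively. -/
def val : Valuation F (WithZero (Multiplicative ℤ)) :=
  (IsDiscreteValuationRing.maximalIdeal P.ring).valuation F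

/-- The order of `f ≠ 0` at `P`: positive at zeros, negative at poles. (It is `0` for `f = 0`;
this value is never used.) -/
def ord (f : F) : ℤ := -WithZero.log (P.val f)

/-- The degree of a place is the degree over `K` of its residue field. -/
def degree : ℕ := Module.finrank K (IsLocalRing.ResidueField P.ring)

/-- A rational point. -/
def IsRational : Prop := P.degree = 1

/-- `f` is regular at `P` and takes the value `c ∈ K` there: `f - c` has positive valuation. -/
def HasValue (f : F) (c : K) : Prop := P.val (f - algebraMap K F c) < 1

open Classical in
/-- The value `f(P) ∈ K` of a function regular at the rational point `P`
(and `0` if there is no such value). -/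
def eval (f : F) : K := if h : ∃ c : K, P.HasValue f c then h.choose else 0

/-- The place `Q` of `F` lies over the place `P` of the subfield `E`, i.e. the map of curves given
by `E ⊆ F` sends the point `Q` to the point `P`. -/
def LiesOver {E : Type*} [Field E] [Algebra K E] [Algebra E F] (Q : Place K F) (P : Place K E) :
    Prop :=
  Q.ring.comap (algebraMap E F) = P.ring

theorem mem_ring_iff (f : F) : f ∈ P.ring ↔ P.val f ≤ 1 := by
  constructor
  · intro h
    exact (IsDiscreteValuationRing.maximalIdeal P.ring).valuation_le_one (K := F) ⟨f, h⟩
  · intro h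
    obtain ⟨a, rfl⟩ := IsDiscreteValuationRing.exists_lift_of_le_one (A := P.ring) (K := F) h
    exact a.2

theorem val_algebraMap {c : K} (hc : c ≠ 0) : P.val (algebraMap K F c) = 1 := by
  apply le_antisymm ((P.mem_ring_iff _).1 (P.algebraMap_mem c))
  have h := (P.mem_ring_iff _).1 (P.algebraMap_mem c⁻¹)
  rw [map_inv₀, map_inv₀] at h
  have h0 : P.val (algebraMap K F c) ≠ 0 := by simpa using hc
  exact (inv_le_one₀ (zero_lt_iff.2 h0)).1 h

theorem HasValue.unique {P : Place K F} {f : F} {c d : K} (hc : P.HasValue f c)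
    (hd : P.HasValue f d) : c = d := by
  by_contra hne
  have h1 := P.val_algebraMap (sub_ne_zero.2 hne)
  have h2 := P.val.map_sub (f - algebraMap K F d) (f - algebraMap K F c)
  rw [sub_sub_sub_cancel_left, ← map_sub, h1] at h2
  exact absurd h2 (not_le.2 (max_lt hd hc))

theorem HasValue.eval_eq {P : Place K F} {f : F} {c : K} (h : P.HasValue f c) :
    P.eval f = c := by
  have h' : ∃ c : K, P.HasValue f c := ⟨c, h⟩
  rw [eval, dif_pos h']
  exact h'.choose_spec.unique h

end Place

/-- Divisors on the curve with function field `F / K`. -/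
abbrev Divisor (K F : Type*) [Field K] [Field F] [Algebra K F] := Place K F →₀ ℤ

namespace Divisor

variable {K F : Type*} [Field K] [Field F] [Algebra K F]

/-- The degree of a divisor. -/
def degree (D : Divisor K F) : ℤ := D.sum fun P a => a * (P.degree : ℤ)

theorem le_ord_iff (P : Place K F) {f : F} (hf : f ≠ 0) (a : ℤ) :
    0 ≤ P.ord f + a ↔ P.val f ≤ WithZero.exp a := by
  have h0 : P.val f ≠ 0 := by simpa using hf
  rw [Place.ord, ← WithZero.log_le_iff_le_exp h0]
  constructor <;> intro h <;> linarith

/-- The Riemann-Roch space `L(D) = {f ∈ F : (f) + D ≥ 0} ∪ {0}`. -/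
def riemannRoch (D : Divisor K F) : Submodule K F where
  carrier := {f | f = 0 ∨ ∀ P : Place K F, 0 ≤ P.ord f + D P}
  zero_mem' := Or.inl rfl
  add_mem' := by
    intro f g hf hg
    by_cases hf0 : f = 0
    · simpa [hf0] using hg
    by_cases hg0 : g = 0
    · simpa [hg0] using hf
    by_cases hfg : f + g = 0
    · exact Or.inl hfg
    refine Or.inr fun P => ?_
    have h1 := (le_ord_iff P hf0 _).1 (hf.resolve_left hf0 P)
    have h2 := (le_ord_iff P hg0 _).1 (hg.resolve_left hg0 P)
    exact (le_ord_iff P hfg _).2 ((P.val.map_add f g).trans (max_le h1 h2))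
  smul_mem' := by
    intro c f hf
    by_cases hc : c = 0
    · exact Or.inl (by simp [hc])
    rcases hf with hf | hf
    · exact Or.inl (by simp [hf])
    · refine Or.inr fun P => ?_
      have h := hf P
      rw [Algebra.smul_def, Place.ord, map_mul, P.val_algebraMap hc, one_mul]
      exact h

end Divisor

/-- The `i`-th gonality over `K` of the curve with function field `F / K`: the least degree of a
divisor (class) `R` defined over `K` with `h⁰(R) ≥ i + 1`. (A divisor of negative degree has
`h⁰ = 0`, so only degrees in `ℕ` matter. Over a finite field the `K`-points of the Picard scheme
are the classes of divisors defined over `K`.) -/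
def gonality (K F : Type*) [Field K] [Field F] [Algebra K F] (i : ℕ) : ℕ :=
  sInf {z : ℕ | ∃ R : Divisor K F, R.degree = (z : ℤ) ∧
    ((i + 1 : ℕ) : Cardinal) ≤ Module.rank K R.riemannRoch}

/-- The support of a linear code: the coordinates at which some codeword is nonzero. -/
def codeSupport {K ι : Type*} [Field K] (C : Submodule K (ι → K)) : Set ι :=
  {i | ∃ c ∈ C, c i ≠ 0}

/-- The `v`-th generalized Hamming weight of a linear code `C`, for `1 ≤ v ≤ dim C`: the least size
of the support of a `v`-dimensional subcode. -/
def genHammingWeight {K ι : Type*} [Field K] (C : Submodule K (ι → K)) (v : ℕ) : ℕ :=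
  sInf {w : ℕ | ∃ D : Submodule K (ι → K), D ≤ C ∧ Module.finrank K D = v ∧
    (codeSupport D).ncard = w}

/-- The data of the Barg-Tamo-Vladut construction, for curves `X`, `Y` over `K` with function
fields `F = K(X)` and `E = K(Y)`; the map `g : X → Y` is the inclusion `E → F`. -/
structure LRCData (K E F : Type*) [Field K] [Field E] [Field F] [Algebra K E] [Algebra K F]
    [Algebra E F] where
  r : ℕ
  s : ℕ
  t : ℕ
  m : ℕ
  /-- `g` is separable -/
  separable : Algebra.IsSeparable E F
  /-- `g` has degree `r + 1` -/
  finrank_eq : Module.finrank E F = r + 1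
  /-- the function `x` with `K(X) = K(Y)(x)` -/
  x : F
  adjoin_x : E⟮x⟯ = ⊤
  /-- the points of `S ⊆ Y(K)` -/
  pointY : Fin s → Place K E
  pointY_injective : Function.Injective pointY
  pointY_rational : ∀ j, (pointY j).IsRational
  /-- the divisor `Q_∞` on `Y`, with support disjoint from `S` -/
  Qinf : Divisor K E
  Qinf_disjoint : ∀ j, pointY j ∉ Qinf.support
  /-- the divisor `D = t Q_∞` is effective -/
  D_effective : 0 ≤ t • Qinf
  /-- the points `P i j` of `X(K)`, which are distinct -/
  point : Fin (r + 1) → Fin s → Place K F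
  point_injective : Function.Injective2 point
  point_rational : ∀ i j, (point i j).IsRational
  /-- `g (P i j)` is the `j`-th point of `S` -/
  point_liesOver : ∀ i j, (point i j).LiesOver (pointY j)
  /-- the points `P i j` are all the points of `g⁻¹(S)` -/
  exists_point : ∀ (Q : Place K F) (j : Fin s), Q.LiesOver (pointY j) → ∃ i, point i j = Q
  /-- in the equation `x ^ (r + 1) + b_r x ^ r + ... + b_0 = 0` of `x` over `K(Y)`, the
  coefficients `b_i`, `1 ≤ i ≤ r`, have poles only along `Q_∞` -/
  coeff_mem : ∀ i, 1 ≤ i → i ≤ r → ∃ a : ℕ, (minpoly E x).coeff i ∈ (a • Qinf).riemannRoch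
  /-- `x` has no pole on `g⁻¹(S)`, so that it can be evaluated there -/
  x_regular : ∀ i j, x ∈ (point i j).ring
  /-- the basis `f_1, ..., f_m` of `L(D)` -/
  f : Module.Basis (Fin m) K (t • Qinf).riemannRoch

namespace LRCData

variable {K E F : Type*} [Field K] [Field E] [Field F] [Algebra K E] [Algebra K F] [Algebra E F]
  (A : LRCData K E F)

/-- The length `n = (r + 1) s` of the code, which is the number of points `P i j`. -/
def n : ℕ := (A.r + 1) * A.s

/-- `ℓ`, the degree of `Q_∞`. -/
def ell : ℤ := A.Qinf.degree

/-- `h`, the degree of `x : X → ℙ¹`, i.e. `[K(X) : K(x)]`. -/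
def h : ℕ := Module.finrank K⟮A.x⟯ F

/-- The evaluation of a function at the points `P i j`. -/
def ev (u : F) : Fin (A.r + 1) × Fin A.s → K := fun p => (A.point p.1 p.2).eval u

/-- The code: the span of the evaluations of `f_j x ^ i`, `0 ≤ i ≤ r - 1`, `1 ≤ j ≤ m`. -/
def code : Submodule K (Fin (A.r + 1) × Fin A.s → K) :=
  Submodule.span K (Set.range fun p : Fin A.r × Fin A.m =>
    A.ev (algebraMap E F (A.f p.2 : E) * A.x ^ (p.1 : ℕ)))

end LRCData

end AGCode

end

/-! Put G = t g^*Q_∞ + (r - 1)(x)_∞. Every f_j x^i with i ≤ r - 1 lies in L(G), and G vanishes at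
the evaluation points. Take a v-dimensional subcode of least support. It is the image of a space W
of functions in L(G), so dim W ≥ v. Evaluation need not be injective. The subcode is zero at n - d_v
coordinates, so W lies in L(G - Z), where Z is the sum of the corresponding points. Hence γ_{v-1} ≤
deg G - (n - d_v), and the theorem follows from deg G ≤ tℓ(r + 1) + (r - 1)h
(`degree_poleDivisor_le`).

The theory of curves behind this consists of degree inequalities, drawn from two estimates for a
quotient A/B of spaces of functions. `sum_degree_le_rank` bounds its dimension below by weak
approximation. `rank_quotient_le` bounds it above by the rank of F over a ring R with a prime π such
that πA ⊆ B. With R = K[z] they bound the zeros of z by [F : K(z)]; with R the ring of a place of E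
they give ∑ e f ≤ [F : E], hence the bound on the degree of a pullback.

The definition of gonality sees only degrees in ℕ, so L(R) ≠ 0 must force deg R ≥ 0. For this, z
must have at least [F : K(z)] poles (`finrank_le_degree_polar`), which follows from the growth of
L(kB), B being the pole divisor of z. -/

noncomputable section

namespace AGCode

open WithZero

/-! ### Orders, weak approximation and leading coefficients at places. -/

namespace Place

section Basic

variable {K F : Type*} [Field K] [Field F] [Algebra K F] (P : Place K F)

theorem exists_uniformizer : ∃ t : F, P.val t = exp (-1) := by
  obtain ⟨t, ht⟩ := (IsDiscreteValuationRing.maximalIdeal P.ring).valuation_exists_uniformizer F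
  exact ⟨t, ht⟩

/-- A uniformizer at `P`. -/
def unif : F := P.exists_uniformizer.choose

theorem val_unif : P.val P.unif = exp (-1) := P.exists_uniformizer.choose_spec

theorem unif_ne_zero : P.unif ≠ 0 := by
  intro h
  have := P.val_unif
  rw [h, map_zero] at this
  exact exp_ne_zero this.symm

theorem val_unif_zpow (a : ℤ) : P.val (P.unif ^ a) = exp (-a) := by
  rw [map_zpow₀, val_unif, ← exp_zsmul]
  simp

theorem val_eq_exp {f : F} (hf : f ≠ 0) : P.val f = exp (-P.ord f) := by
  rw [ord, neg_neg, exp_log]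
  simpa using hf

theorem ord_mul {f g : F} (hf : f ≠ 0) (hg : g ≠ 0) : P.ord (f * g) = P.ord f + P.ord g := by
  rw [ord, ord, ord, map_mul, log_mul (by simpa using hf) (by simpa using hg)]
  ring

theorem ord_inv (f : F) : P.ord f⁻¹ = -P.ord f := by
  rw [ord, ord, map_inv₀, log_inv]

theorem ord_zero : P.ord (0 : F) = 0 := by simp [ord]

theorem ord_pow (f : F) (n : ℕ) : P.ord (f ^ n) = n * P.ord f := by
  rw [ord, ord, map_pow, log_pow]
  simp

theorem ord_unif : P.ord P.unif = 1 := by simp [ord, val_unif]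

theorem ord_algebraMap (c : K) : P.ord (algebraMap K F c) = 0 := by
  by_cases hc : c = 0
  · simp [hc, ord_zero]
  · simp [ord, P.val_algebraMap hc]

theorem val_lt_one_iff {f : F} (hf : f ≠ 0) : P.val f < 1 ↔ 0 < P.ord f := by
  rw [P.val_eq_exp hf, ← exp_zero, exp_lt_exp]
  omega

theorem val_le_exp_sub_one_iff {f : F} {a : ℤ} : P.val f ≤ exp (a - 1) ↔ P.val f < exp a := by
  by_cases hf : f = 0
  · simp [hf]
  · rw [P.val_eq_exp hf, exp_lt_exp, exp_le_exp]
    omega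

/-- A discrete valuation ring is maximal among proper subrings: powers of one element with a pole at
P absorb the pole of any other, so a strictly larger ring would be the whole field. -/
theorem eq_of_ring_le {P Q : Place K F} (h : P.ring ≤ Q.ring) : P = Q := by
  refine Place.ext (le_antisymm h fun f hf => ?_)
  by_contra hfP
  have h1 : 1 < P.val f := by
    rw [mem_ring_iff] at hfP
    exact not_le.1 hfP
  have hf0 : f ≠ 0 := by
    rintro rfl
    simp at h1
  -- then `Q.ring` contains every element of the field
  have hall : ∀ y : F, y ∈ Q.ring := by
    intro y
    by_cases hy : y = 0
    · rw [hy]; exact zero_mem _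
    have hord : P.ord f < 0 := by
      rw [P.val_eq_exp hf0, ← exp_zero, exp_lt_exp] at h1
      omega
    obtain ⟨k, hk⟩ : ∃ k : ℕ, 0 ≤ P.ord y - k * P.ord f := by
      refine ⟨(P.ord y).natAbs, ?_⟩
      have h2 : -((P.ord y).natAbs : ℤ) ≤ P.ord y := by omega
      nlinarith [Int.natCast_nonneg (P.ord y).natAbs]
    have h3 : y * (f ^ k)⁻¹ ∈ P.ring := by
      rw [mem_ring_iff, P.val_eq_exp (mul_ne_zero hy (inv_ne_zero (pow_ne_zero _ hf0))),
        ord_mul _ hy (inv_ne_zero (pow_ne_zero _ hf0)), ord_inv, ord_pow, ← exp_zero, exp_le_exp]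
      linarith
    have h4 := mul_mem (h h3) (pow_mem hf k)
    rwa [inv_mul_cancel_right₀ (pow_ne_zero _ hf0)] at h4
  have h5 := (Q.mem_ring_iff _).1 (hall Q.unif⁻¹)
  rw [map_inv₀, val_unif, ← exp_neg, ← exp_zero, exp_le_exp] at h5
  omega

theorem exists_separating {P Q : Place K F} (h : P ≠ Q) : ∃ z : F, P.val z < 1 ∧ 1 < Q.val z := by
  obtain ⟨a, haP, haQ⟩ := Set.not_subset.1 fun hle : (P.ring : Set F) ⊆ Q.ring =>
    h (eq_of_ring_le hle)
  obtain ⟨b, hbQ, hbP⟩ := Set.not_subset.1 fun hle : (Q.ring : Set F) ⊆ P.ring =>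
    h (eq_of_ring_le hle).symm
  rw [SetLike.mem_coe, mem_ring_iff] at haP haQ hbP hbQ
  rw [not_le] at haQ hbP
  have hb0 : b ≠ 0 := by
    rintro rfl
    simp at hbP
  refine ⟨a / b, ?_, ?_⟩
  · rw [map_div₀]
    exact (div_lt_one₀ (zero_lt_one.trans hbP)).2 (haP.trans_lt hbP)
  · have hbQ0 : 0 < Q.val b := zero_lt_iff.2 (by simpa using hb0)
    rw [map_div₀]
    exact (one_lt_div₀ hbQ0).2 (hbQ.trans_lt haQ)

theorem exists_val_lt_one_and_one_lt (P : Place K F) (S : Finset (Place K F)) (hP : P ∉ S) :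
    ∃ y : F, P.val y < 1 ∧ ∀ Q ∈ S, 1 < Q.val y := by
  classical
  induction S using Finset.induction_on with
  | empty => exact ⟨0, by simp⟩
  | insert Q S hQ ih =>
    simp only [Finset.mem_insert, not_or] at hP
    obtain ⟨y, hyP, hyS⟩ := ih hP.2
    obtain ⟨z, hzP, hzQ⟩ := exists_separating hP.1
    by_cases hyQ : 1 < Q.val y
    · refine ⟨y, hyP, fun R hR => ?_⟩
      rcases Finset.mem_insert.1 hR with rfl | hR
      exacts [hyQ, hyS R hR]
    rw [not_lt] at hyQ
    -- The new element is y + z ^ k. The exponent must avoid 0 and any tie between z ^ k and y at a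
    -- place of S; as y has a pole there, each place excludes at most one k.
    have hfin : ({0} ∪ ⋃ R ∈ S, {k : ℕ | R.val z ^ k = R.val y}).Finite := by
      refine (Set.finite_singleton 0).union (S.finite_toSet.biUnion fun R hR => ?_)
      refine Set.Subsingleton.finite fun k hk l hl => ?_
      have hy := hyS R hR
      have hlog : 0 < log (R.val y) := by
        rw [← log_one (M := ℤ)]
        exact (log_lt_log one_ne_zero (zero_lt_one.trans hy).ne').2 hy
      have e1 : (k : ℤ) * log (R.val z) = log (R.val y) := by
        rw [← (show _ = _ from hk), log_pow]; simp
      have e2 : (l : ℤ) * log (R.val z) = log (R.val y) := by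
        rw [← (show _ = _ from hl), log_pow]; simp
      have h0 : log (R.val z) ≠ 0 := by
        intro h0
        rw [h0] at e1
        simp at e1
        omega
      exact_mod_cast mul_right_cancel₀ h0 (e1.trans e2.symm)
    obtain ⟨k, hk⟩ := hfin.exists_notMem
    simp only [Set.mem_union, Set.mem_singleton_iff, Set.mem_iUnion, Set.mem_ofPred_eq, not_or,
      not_exists] at hk
    refine ⟨y + z ^ k, (P.val.map_add _ _).trans_lt (max_lt hyP ?_), fun R hR => ?_⟩
    · rw [map_pow]
      exact pow_lt_one₀ zero_le hzP hk.1
    · rcases Finset.mem_insert.1 hR with rfl | hR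
      · have h1 : 1 < R.val (z ^ k) := by
          rw [map_pow]
          exact one_lt_pow₀ hzQ hk.1
        rwa [Valuation.map_add_eq_of_lt_right _ (hyQ.trans_lt h1)]
      · have hne : R.val y ≠ R.val (z ^ k) := by
          rw [map_pow]
          exact fun h => hk.2 R hR h.symm
        rw [Valuation.map_add_of_distinct_val _ hne]
        exact lt_max_of_lt_left (hyS R hR)

/-- Weak approximation: an element close to `1` at `P` and close to `0` at finitely many other
places. -/
theorem exists_approx (P : Place K F) (S : Finset (Place K F)) (hP : P ∉ S) (N : ℕ) :
    ∃ e : F, P.val (e - 1) < 1 ∧ ∀ Q ∈ S, Q.val e ≤ exp (-(N : ℤ)) := by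
  obtain ⟨y, hyP, hyS⟩ := P.exists_val_lt_one_and_one_lt S hP
  have hyk : P.val (y ^ (N + 1)) < 1 := by
    rw [map_pow]
    exact pow_lt_one₀ zero_le hyP (by omega)
  have h1 : P.val (1 + y ^ (N + 1)) = 1 := by
    rw [Valuation.map_add_eq_of_lt_left, map_one]
    rwa [map_one]
  have h0 : 1 + y ^ (N + 1) ≠ 0 := by
    intro h
    rw [h, map_zero] at h1
    exact zero_ne_one h1
  -- Where y is small this is close to 1; where y has a pole it has a zero of order at least N + 1.
  refine ⟨(1 + y ^ (N + 1))⁻¹, ?_, fun Q hQ => ?_⟩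
  · have : (1 + y ^ (N + 1))⁻¹ - 1 = -(y ^ (N + 1) * (1 + y ^ (N + 1))⁻¹) := by
      field_simp
      ring
    rw [this, Valuation.map_neg, map_mul, map_inv₀, h1, inv_one, mul_one]
    exact hyk
  · have hy := hyS Q hQ
    have hy0 : y ≠ 0 := by
      rintro rfl
      simp at hy
    have h2 : 1 < Q.val (y ^ (N + 1)) := by
      rw [map_pow]
      exact one_lt_pow₀ hy (by omega)
    have hord : Q.ord y < 0 := by
      rw [Q.val_eq_exp hy0, ← exp_zero, exp_lt_exp] at hy
      omega
    rw [map_inv₀, Valuation.map_add_eq_of_lt_right _ (by rwa [map_one]),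
      Q.val_eq_exp (pow_ne_zero _ hy0), ← exp_neg, exp_le_exp, ord_pow]
    push_cast
    nlinarith [Int.natCast_nonneg N]

/-- The functions with a pole of order at most `a` at `P`. -/
def localSub (a : ℤ) : Submodule K F where
  carrier := {f | P.val f ≤ exp a}
  zero_mem' := by simp
  add_mem' hf hg := (P.val.map_add _ _).trans (max_le hf hg)
  smul_mem' c f hf := by
    by_cases hc : c = 0
    · simp [hc]
    · simpa [Algebra.smul_def, P.val_algebraMap hc] using hf

theorem mem_localSub {a : ℤ} {f : F} : f ∈ P.localSub a ↔ P.val f ≤ exp a := Iff.rfl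

theorem mem_localSub_iff_ord {a : ℤ} {f : F} (hf : f ≠ 0) : f ∈ P.localSub a ↔ 0 ≤ P.ord f + a :=
  (Divisor.le_ord_iff P hf a).symm

instance : IsScalarTower K P.ring F := IsScalarTower.of_algebraMap_eq fun _ => rfl

instance : IsScalarTower K P.ring (IsLocalRing.ResidueField P.ring) :=
  IsScalarTower.of_algebraMap_eq fun _ => rfl

/-- The leading coefficient at `P` of a function with a pole of order at most `a`. -/
def leadingCoeff (a : ℤ) : P.localSub a →ₗ[K] IsLocalRing.ResidueField P.ring :=
  (IsScalarTower.toAlgHom K P.ring (IsLocalRing.ResidueField P.ring)).toLinearMap ∘ₗ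
  { toFun := fun f => ⟨f * P.unif ^ a, by
      rw [mem_ring_iff, map_mul, val_unif_zpow, ← exp_zero, ← add_neg_cancel a, exp_add]
      exact mul_le_mul_left f.2 _⟩
    map_add' := fun f g => Subtype.ext (add_mul _ _ _)
    map_smul' := fun c f => Subtype.ext (by
      rw [Algebra.smul_def]
      exact (congrArg (· * P.unif ^ a) (Algebra.smul_def c (f : F))).trans (mul_assoc _ _ _)) }

theorem leadingCoeff_apply (a : ℤ) (f : P.localSub a) (h : (f : F) * P.unif ^ a ∈ P.ring) :
    P.leadingCoeff a f = IsLocalRing.residue P.ring ⟨f * P.unif ^ a, h⟩ := rfl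

theorem residue_eq_zero_iff (f : P.ring) :
    IsLocalRing.residue P.ring f = 0 ↔ P.val (f : F) < 1 := by
  rw [IsLocalRing.residue_eq_zero_iff]
  exact ((IsDiscreteValuationRing.maximalIdeal P.ring).valuation_lt_one_iff_mem (K := F) f).symm

/-- Lowering the allowed pole order at P by one thus costs at most the dimension of the residue
field. -/
theorem leadingCoeff_eq_zero_iff (a : ℤ) (f : P.localSub a) :
    P.leadingCoeff a f = 0 ↔ (f : F) ∈ P.localSub (a - 1) := by
  have h : (f : F) * P.unif ^ a ∈ P.ring := by
      rw [mem_ring_iff, map_mul, val_unif_zpow, ← exp_zero, ← add_neg_cancel a, exp_add]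
      exact mul_le_mul_left f.2 _
  rw [P.leadingCoeff_apply a f h, residue_eq_zero_iff, mem_localSub, val_le_exp_sub_one_iff,
    map_mul, val_unif_zpow, exp_neg, ← div_eq_mul_inv, div_lt_one₀ (by simp [zero_lt_iff])]

end Basic

end Place

/-! ### Upper bounds for quotients by reduction modulo a prime element. -/

section Reduction

variable {K R M : Type*} [Field K] [CommRing R] [IsDomain R] [IsNoetherianRing R]
  [AddCommGroup M] [Module R M] [Module.IsTorsionFree R M]

/-- A family which is linearly independent modulo a prime element is linearly independent. -/
theorem linearIndependent_of_reduction {ι : Type*} {u : ι → M} {π : R} (hπ : π ≠ 0)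
    (hmax : (Ideal.span {π}).IsMaximal)
    (hu : LinearIndependent (R ⧸ Ideal.span {π})
      fun i => Submodule.Quotient.mk (p := (Ideal.span {π} • ⊤ : Submodule R M)) (u i)) :
    LinearIndependent R u := by
  rw [linearIndependent_iff'] at hu ⊢
  intro s
  -- Infinite descent: the coefficients of a relation vanish modulo π, and dividing the relation by
  -- π gives another one. In a Noetherian domain only 0 is divisible by every power of a nonzero
  -- nonunit.
  have hstep : ∀ k : ℕ, ∀ φ : ι → R, ∑ i ∈ s, φ i • u i = 0 → ∀ i ∈ s, π ^ k ∣ φ i := by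
    intro k
    induction k with
    | zero => intro φ _ i _; simp
    | succ k ih =>
      intro φ hφ
      have h1 : ∀ i ∈ s, π ∣ φ i := by
        intro i hi
        have h2 := hu s (fun i => Ideal.Quotient.mk _ (φ i)) (by
          simp_rw [Module.Quotient.mk_smul_mk]
          have h3 := congrArg (Submodule.mkQ (Ideal.span {π} • ⊤ : Submodule R M)) hφ
          rw [map_sum, map_zero] at h3
          exact h3) i hi
        rwa [Ideal.Quotient.eq_zero_iff_mem, Ideal.mem_span_singleton] at h2
      choose! ψ hψ using h1
      have h4 : π • ∑ i ∈ s, ψ i • u i = 0 := by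
        rw [Finset.smul_sum, ← hφ]
        exact Finset.sum_congr rfl fun i hi => by rw [smul_smul, hψ i hi]
      have h5 := ih ψ ((smul_eq_zero_iff_right hπ).1 h4)
      intro i hi
      rw [hψ i hi, pow_succ']
      exact mul_dvd_mul_left _ (h5 i hi)
  intro φ hφ i hi
  by_contra h0
  have hfin : FiniteMultiplicity π (φ i) := by
    refine FiniteMultiplicity.of_not_isUnit (fun hunit => hmax.ne_top ?_) h0
    exact Ideal.span_singleton_eq_top.2 hunit
  obtain ⟨k, hk⟩ := hfin
  exact hk (hstep (k + 1) φ hφ i hi)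

theorem rank_reduction_le {π : R} (hπ : π ≠ 0) (hmax : (Ideal.span {π}).IsMaximal) :
    Module.rank (R ⧸ Ideal.span {π}) (M ⧸ (Ideal.span {π} • ⊤ : Submodule R M)) ≤
      Module.rank R M := by
  let _ := Ideal.Quotient.field (Ideal.span {π})
  let b := Module.Basis.ofVectorSpace (R ⧸ Ideal.span {π})
    (M ⧸ (Ideal.span {π} • ⊤ : Submodule R M))
  choose u hu using fun i => Submodule.Quotient.mk_surjective _ (b i)
  rw [← b.mk_eq_rank'']
  refine LinearIndependent.cardinal_le_rank (v := u)
    (linearIndependent_of_reduction hπ hmax ?_)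
  simp_rw [hu]
  exact b.linearIndependent

variable [Algebra K R] [Module K M] [IsScalarTower K R M]

theorem rank_reduction_base_le {π : R} (hπ : π ≠ 0) (hmax : (Ideal.span {π}).IsMaximal)
    [Module.Finite K (R ⧸ Ideal.span {π})] {n : ℕ} (hn : Module.rank R M ≤ n) :
    Module.rank K (M ⧸ (Ideal.span {π} • ⊤ : Submodule R M)) ≤
      (n * Module.finrank K (R ⧸ Ideal.span {π}) : ℕ) := by
  let _ := Ideal.Quotient.field (Ideal.span {π})
  have h1 := (rank_reduction_le (M := M) hπ hmax).trans hn
  have : IsScalarTower K (R ⧸ Ideal.span {π}) (M ⧸ (Ideal.span {π} • ⊤ : Submodule R M)) :=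
    inferInstance
  have : Module.Finite (R ⧸ Ideal.span {π}) (M ⧸ (Ideal.span {π} • ⊤ : Submodule R M)) :=
    Module.rank_lt_aleph0_iff.1 (h1.trans_lt (Cardinal.natCast_lt_aleph0))
  have : Module.Finite K (M ⧸ (Ideal.span {π} • ⊤ : Submodule R M)) :=
    Module.Finite.trans (R ⧸ Ideal.span {π}) _
  rw [← Module.finrank_eq_rank, Nat.cast_le, ← Module.finrank_mul_finrank K (R ⧸ Ideal.span {π}),
    mul_comm]
  refine Nat.mul_le_mul_right _ ?_
  rwa [← Module.finrank_eq_rank, Nat.cast_le] at h1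

/-- If `A` is an `R`-stable subspace of a module of rank at most `n` and `π A ⊆ B`, then `A / B`
has dimension at most `n [R / π : K]`. -/
theorem rank_quotient_le {π : R} (hπ : π ≠ 0) (hmax : (Ideal.span {π}).IsMaximal)
    [Module.Finite K (R ⧸ Ideal.span {π})] {n : ℕ} (hn : Module.rank R M ≤ n)
    (A B : Submodule K M) (hA : ∀ (a : R), ∀ m ∈ A, a • m ∈ A) (hB : ∀ m ∈ A, π • m ∈ B) :
    Module.rank K (A ⧸ B.submoduleOf A) ≤ (n * Module.finrank K (R ⧸ Ideal.span {π}) : ℕ) := by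
  -- V is A seen as an R-module. Since πV ⊆ B, the quotient A / B is an image of V / πV, whose
  -- dimension is controlled by the rank of V.
  let V : Submodule R M := { A.toAddSubmonoid with smul_mem' := hA }
  have hV : Module.rank R V ≤ n := (Submodule.rank_le V).trans hn
  let g : V →ₗ[K] A ⧸ B.submoduleOf A := (B.submoduleOf A).mkQ ∘ₗ
    { toFun := fun x => ⟨x, x.2⟩
      map_add' := fun _ _ => rfl
      map_smul' := fun _ _ => rfl }
  have hg : Function.Surjective g := by
    intro y
    obtain ⟨x, rfl⟩ := Submodule.mkQ_surjective _ y
    exact ⟨⟨x, x.2⟩, rfl⟩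
  have hker : ((Ideal.span {π} • ⊤ : Submodule R V).restrictScalars K) ≤ LinearMap.ker g := by
    intro x hx
    rw [Submodule.restrictScalars_mem, Submodule.ideal_span_singleton_smul,
      Submodule.mem_smul_pointwise_iff_exists] at hx
    obtain ⟨y, -, rfl⟩ := hx
    exact (Submodule.Quotient.mk_eq_zero _).2 (hB y y.2)
  refine le_trans ?_ (rank_reduction_base_le (K := K) (M := V) hπ hmax hV)
  let g' : (V ⧸ (Ideal.span {π} • ⊤ : Submodule R V)) →ₗ[K] A ⧸ B.submoduleOf A :=
    Submodule.liftQ ((Ideal.span {π} • ⊤ : Submodule R V).restrictScalars K) g hker ∘ₗ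
      (Submodule.Quotient.restrictScalarsEquiv K (Ideal.span {π} • ⊤ : Submodule R V)).symm
  refine LinearMap.rank_le_of_surjective g' fun y => ?_
  obtain ⟨x, rfl⟩ := hg y
  exact ⟨Submodule.Quotient.mk x, rfl⟩

end Reduction

/-! ### The case R = K[z], π = z. -/

section Simple

variable {K F : Type*} [Field K] [Field F] [Algebra K F]

theorem exists_aeval_eq_of_mem_adjoin {z a : F} (ha : a ∈ Algebra.adjoin K {z}) :
    ∃ p : Polynomial K, Polynomial.aeval z p = a := by
  rwa [Algebra.adjoin_singleton_eq_range_aeval] at ha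

theorem adjoin_decomp (z : F) (a : Algebra.adjoin K {z}) :
    ∃ (c : K) (b : Algebra.adjoin K {z}),
      a = algebraMap K _ c + ⟨z, Algebra.self_mem_adjoin_singleton K z⟩ * b := by
  obtain ⟨a, ha⟩ := a
  obtain ⟨p, rfl⟩ := exists_aeval_eq_of_mem_adjoin ha
  refine ⟨p.coeff 0, ⟨Polynomial.aeval z p.divX, ?_⟩, Subtype.ext ?_⟩
  · rw [Algebra.adjoin_singleton_eq_range_aeval]
    exact ⟨_, rfl⟩
  · have h := congrArg (Polynomial.aeval z) p.X_mul_divX_add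
    rw [map_add, map_mul, Polynomial.aeval_X, Polynomial.aeval_C] at h
    exact h.symm.trans (add_comm _ _)

/-- Taking constant terms identifies K[z]/(z) with K. Transcendence is what keeps z from being a
unit: an inverse p(z) would be a root relation z p(z) - 1 = 0. -/
theorem adjoin_span_isMaximal {z : F} (hz : Transcendental K z) :
    (Ideal.span {(⟨z, Algebra.self_mem_adjoin_singleton K z⟩ : Algebra.adjoin K {z})}).IsMaximal ∧
    Module.finrank K (Algebra.adjoin K {z} ⧸
      Ideal.span {(⟨z, Algebra.self_mem_adjoin_singleton K z⟩ : Algebra.adjoin K {z})}) = 1 ∧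
    Module.Finite K (Algebra.adjoin K {z} ⧸
      Ideal.span {(⟨z, Algebra.self_mem_adjoin_singleton K z⟩ : Algebra.adjoin K {z})}) := by
  set z' : Algebra.adjoin K {z} := ⟨z, Algebra.self_mem_adjoin_singleton K z⟩
  have hsurj : Function.Surjective (algebraMap K (Algebra.adjoin K {z} ⧸ Ideal.span {z'})) := by
    intro y
    obtain ⟨a, rfl⟩ := Ideal.Quotient.mk_surjective y
    obtain ⟨c, b, hb⟩ := adjoin_decomp z a
    refine ⟨c, ?_⟩
    rw [hb, map_add, map_mul, Ideal.Quotient.eq_zero_iff_mem.2 (Ideal.mem_span_singleton_self z'),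
      zero_mul, add_zero]
    rfl
  have hne : Ideal.span {z'} ≠ ⊤ := by
    rw [Ne, Ideal.span_singleton_eq_top]
    rintro ⟨w, hw⟩
    have hmem := (w⁻¹).1.2
    obtain ⟨p, hp⟩ := exists_aeval_eq_of_mem_adjoin hmem
    have h1 : z * Polynomial.aeval z p = 1 := by
      rw [hp]
      have := congrArg Subtype.val w.mul_inv
      rwa [hw] at this
    refine hz ⟨Polynomial.X * p - 1, fun h0 => ?_, by simp [h1]⟩
    have := congrArg (Polynomial.eval 0) h0
    simp at this
  have : Nontrivial (Algebra.adjoin K {z} ⧸ Ideal.span {z'}) := Ideal.Quotient.nontrivial_iff.2 hne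
  have hbij : Function.Bijective (algebraMap K (Algebra.adjoin K {z} ⧸ Ideal.span {z'})) :=
    ⟨(algebraMap K _).injective, hsurj⟩
  let e : K ≃ₗ[K] Algebra.adjoin K {z} ⧸ Ideal.span {z'} :=
    LinearEquiv.ofBijective (Algebra.linearMap K _) hbij
  refine ⟨?_, ?_, Module.Finite.equiv e⟩
  · refine Ideal.Quotient.maximal_of_isField _ ?_
    exact (RingEquiv.ofBijective _ hbij).symm.toMulEquiv.isField (Field.toIsField K)
  · rw [← e.finrank_eq, Module.finrank_self]

open scoped IntermediateField.algebraAdjoinAdjoin in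
/-- If `A` is stable under `z` and `z A ⊆ B`, then `A / B` has dimension at most `[F : K(z)]`. -/
theorem rank_quotient_le_finrank_adjoin {z : F} (hz : Transcendental K z)
    [FiniteDimensional K⟮z⟯ F] (A B : Submodule K F) (hA : ∀ f ∈ A, z * f ∈ A)
    (hB : ∀ f ∈ A, z * f ∈ B) :
    Module.rank K (A ⧸ B.submoduleOf A) ≤ (Module.finrank K⟮z⟯ F : ℕ) := by
  obtain ⟨h1, h2, h3⟩ := adjoin_span_isMaximal hz
  have : IsNoetherianRing (Algebra.adjoin K {z}) := by
    have : Algebra.FiniteType K (Algebra.adjoin K {z}) :=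
      (Algebra.adjoin K {z}).fg_iff_finiteType.1 ⟨{z}, by simp⟩
    exact Algebra.FiniteType.isNoetherianRing K _
  have hz0 : z ≠ 0 := fun h => hz (h ▸ isAlgebraic_zero)
  -- The rank does not change on passing from K[z] to its fraction field K(z).
  have hn : Module.rank (Algebra.adjoin K {z}) F ≤ (Module.finrank K⟮z⟯ F : ℕ) := by
    rw [Module.finrank_eq_rank]
    exact (IsLocalization.rank_eq K⟮z⟯ (nonZeroDivisors (Algebra.adjoin K {z})) le_rfl).ge
  have h := rank_quotient_le (K := K) (M := F) (fun h0 => hz0 (congrArg Subtype.val h0)) h1 hn A B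
    (fun a => ?_) (fun m hm => hB m hm)
  · rwa [h2, mul_one] at h
  · obtain ⟨a, ha⟩ := a
    intro m hm
    change a * m ∈ A
    induction ha using Algebra.adjoin_induction generalizing m with
    | mem x hx => rw [Set.mem_singleton_iff.1 hx]; exact hA m hm
    | algebraMap r => rw [← Algebra.smul_def]; exact A.smul_mem r hm
    | add x y _ _ hx hy => rw [add_mul]; exact A.add_mem (hx m hm) (hy m hm)
    | mul x y _ _ hx hy => rw [mul_assoc]; exact hx _ (hy m hm)

end Simple

/-! ### Dimensions of successive quotients. -/

section RelativeRank

universe v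

variable {K : Type*} {M : Type v} [Field K] [AddCommGroup M] [Module K M]

theorem rank_quotient_add_le {A B C : Submodule K M} (hCB : C ≤ B) (hBA : B ≤ A) :
    Module.rank K (A ⧸ B.submoduleOf A) + Module.rank K (B ⧸ C.submoduleOf B) ≤
      Module.rank K (A ⧸ C.submoduleOf A) := by
  let f : (A ⧸ C.submoduleOf A) →ₗ[K] (A ⧸ B.submoduleOf A) :=
    Submodule.factor (Submodule.comap_mono hCB)
  have hf : Function.Surjective f := Submodule.factor_surjective _
  rw [LinearMap.rank_eq_of_surjective hf]
  gcongr
  let g : (B ⧸ C.submoduleOf B) →ₗ[K] (A ⧸ C.submoduleOf A) :=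
    Submodule.mapQ _ _ (Submodule.inclusion hBA) fun x hx => hx
  have hg : Function.Injective g := by
    rw [← LinearMap.ker_eq_bot, LinearMap.ker_eq_bot']
    intro x hx
    obtain ⟨x, rfl⟩ := Submodule.mkQ_surjective _ x
    have hx' : (Submodule.Quotient.mk (Submodule.inclusion hBA x) : A ⧸ C.submoduleOf A) = 0 := hx
    rw [Submodule.Quotient.mk_eq_zero] at hx'
    exact (Submodule.Quotient.mk_eq_zero _).2 hx'
  have hgf : ∀ x, g x ∈ LinearMap.ker f := by
    intro x
    obtain ⟨x, rfl⟩ := Submodule.mkQ_surjective _ x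
    exact (Submodule.Quotient.mk_eq_zero _).2 x.2
  exact LinearMap.rank_le_of_injective (g.codRestrict _ hgf) fun x y hxy =>
    hg (congrArg Subtype.val hxy)

theorem rank_le_quotient_of_surjective {N : Type v} [AddCommGroup N] [Module K N]
    {A B : Submodule K M} (g : A →ₗ[K] N) (hg : Function.Surjective g)
    (hB : ∀ x : A, (x : M) ∈ B → g x = 0) :
    Module.rank K N ≤ (Module.rank K (A ⧸ B.submoduleOf A)) := by
  refine LinearMap.rank_le_of_surjective (Submodule.liftQ (B.submoduleOf A) g hB) fun y => ?_
  obtain ⟨x, rfl⟩ := hg y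
  exact ⟨Submodule.Quotient.mk x, rfl⟩

end RelativeRank

/-! ### Lower bounds for quotients from conditions at finitely many places. -/

namespace Place

section Semilocal

variable {K F : Type*} [Field K] [Field F] [Algebra K F]

/-- The functions whose pole order at each place of `S` is bounded by `D`. -/
def semilocalSub (S : Finset (Place K F)) (D : Place K F → ℤ) : Submodule K F :=
  ⨅ P ∈ S, P.localSub (D P)

theorem mem_semilocalSub {S : Finset (Place K F)} {D : Place K F → ℤ} {f : F} :
    f ∈ semilocalSub S D ↔ ∀ P ∈ S, P.val f ≤ exp (D P) := by
  simp [semilocalSub, Submodule.mem_iInf, mem_localSub]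

theorem semilocalSub_mono {S : Finset (Place K F)} {D D' : Place K F → ℤ} (h : D ≤ D') :
    semilocalSub S D ≤ semilocalSub S D' := fun _ hf =>
  mem_semilocalSub.2 fun P hP => (mem_semilocalSub.1 hf P hP).trans (exp_le_exp.2 (h P))

/-- A lift of y times a power of the uniformizer has the right leading coefficient at P but
uncontrolled poles on the rest of S. Multiplying by an approximation of 1 at P and of 0 at the other
places repairs them without changing the coefficient. -/
theorem leadingCoeff_semilocalSub_surjective (S : Finset (Place K F)) (D : Place K F → ℤ)
    {P : Place K F} (_ : P ∈ S) (y : IsLocalRing.ResidueField P.ring) :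
    ∃ f ∈ semilocalSub S D, ∃ hf : f ∈ P.localSub (D P), P.leadingCoeff (D P) ⟨f, hf⟩ = y := by
  classical
  obtain ⟨c, rfl⟩ := IsLocalRing.residue_surjective y
  let g : F := c * P.unif ^ (-D P)
  have hcg : g * P.unif ^ D P = c := by
    rw [mul_assoc, ← zpow_add₀ P.unif_ne_zero, neg_add_cancel, zpow_zero, mul_one]
  have hgP : P.val g ≤ exp (D P) := by
    rw [map_mul, val_unif_zpow, neg_neg]
    exact mul_le_of_le_one_left zero_le ((P.mem_ring_iff _).1 c.2)
  obtain ⟨N, hN⟩ : ∃ N : ℕ, ∀ Q ∈ S, Q.val g ≤ exp ((N : ℤ) + D Q) := by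
    refine ⟨∑ Q ∈ S, (log (Q.val g) - D Q).natAbs, fun Q hQ => ?_⟩
    refine WithZero.le_exp_of_log_le ?_
    have := Finset.single_le_sum (f := fun Q : Place K F => (log (Q.val g) - D Q).natAbs)
      (fun _ _ => Nat.zero_le _) hQ
    omega
  obtain ⟨e, heP, heS⟩ := P.exists_approx (S.erase P) (Finset.notMem_erase _ _) N
  have heP1 : P.val e ≤ 1 := by
    have := P.val.map_add (e - 1) 1
    rw [sub_add_cancel, map_one, max_eq_right heP.le] at this
    exact this
  have hf : g * e ∈ P.localSub (D P) := by
    rw [mem_localSub, map_mul]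
    exact (mul_le_of_le_one_right zero_le heP1).trans hgP
  refine ⟨g * e, mem_semilocalSub.2 fun Q hQ => ?_, hf, ?_⟩
  · by_cases hQP : Q = P
    · rw [hQP]; exact hf
    · have h1 := mul_le_mul' (hN Q hQ) (heS Q (Finset.mem_erase.2 ⟨hQP, hQ⟩))
      rw [map_mul]
      refine h1.trans_eq ?_
      rw [← exp_add]
      congr 1
      ring
  · have hg : g ∈ P.localSub (D P) := hgP
    have h1 : P.leadingCoeff (D P) ⟨g, hg⟩ = IsLocalRing.residue P.ring c := by
      rw [P.leadingCoeff_apply (D P) ⟨g, hg⟩ (by rw [hcg]; exact c.2)]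
      exact congrArg _ (Subtype.ext hcg)
    rw [← h1, ← sub_eq_zero, ← map_sub, leadingCoeff_eq_zero_iff, mem_localSub,
      val_le_exp_sub_one_iff]
    change P.val (g * e - g) < _
    rw [← mul_sub_one, map_mul]
    by_cases hg0 : P.val g = 0
    · rw [hg0, zero_mul]
      exact exp_pos
    · exact (mul_lt_of_lt_one_right (zero_lt_iff.2 hg0) heP).trans_le hgP

/-- Stated with cardinals because residue fields are not yet known to be finite over K; this
inequality is used to prove it. -/
theorem rank_residueField_le [DecidableEq (Place K F)] (S : Finset (Place K F))
    (D : Place K F → ℤ) {P : Place K F} (hP : P ∈ S) :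
    Module.rank K (IsLocalRing.ResidueField P.ring) ≤
      Module.rank K (semilocalSub S D ⧸
        (semilocalSub S (Function.update D P (D P - 1))).submoduleOf (semilocalSub S D)) := by
  let g := P.leadingCoeff (D P) ∘ₗ Submodule.inclusion
    (show semilocalSub S D ≤ P.localSub (D P) from fun f hf => mem_semilocalSub.1 hf P hP)
  refine rank_le_quotient_of_surjective g (fun y => ?_) fun f hf => ?_
  · obtain ⟨f, hfS, hf, rfl⟩ := leadingCoeff_semilocalSub_surjective S D hP y
    exact ⟨⟨f, hfS⟩, rfl⟩
  · refine (P.leadingCoeff_eq_zero_iff _ _).2 ?_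
    have := mem_semilocalSub.1 hf P hP
    rwa [Function.update_self] at this

theorem sum_degree_le_rank (S : Finset (Place K F)) (n : Place K F → ℕ) (D : Place K F → ℤ) :
    ((∑ P ∈ S, n P * P.degree : ℕ) : Cardinal) ≤
      Module.rank K (semilocalSub S D ⧸
        (semilocalSub S fun P => D P - n P).submoduleOf (semilocalSub S D)) := by
  classical
  obtain ⟨N, hN⟩ : ∃ N, ∑ P ∈ S, n P = N := ⟨_, rfl⟩
  induction N generalizing n D with
  | zero =>
    have h0 : ∑ P ∈ S, n P * P.degree = 0 :=
      Finset.sum_eq_zero fun P hP => by rw [Finset.sum_eq_zero_iff.1 hN P hP, zero_mul]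
    rw [h0]
    simp
  | succ N ih =>
    obtain ⟨P, hP, hnP⟩ : ∃ P ∈ S, n P ≠ 0 := by
      by_contra! h
      rw [Finset.sum_eq_zero h] at hN
      omega
    let n' := Function.update n P (n P - 1)
    -- One splitting serves two sums: ∑ n, which drives the induction, and ∑ n deg, which is being
    -- bounded.
    have hsum : ∀ φ : ℕ → Place K F → ℕ, (φ (n P) P = φ (n P - 1) P + φ 1 P) →
        ∑ Q ∈ S, φ (n Q) Q = ∑ Q ∈ S, φ (n' Q) Q + φ 1 P := by
      intro φ hφ
      rw [← Finset.add_sum_erase _ _ hP, ← Finset.add_sum_erase S (fun Q => φ (n' Q) Q) hP,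
        hφ, show n' P = n P - 1 from Function.update_self ..]
      have : ∑ Q ∈ S.erase P, φ (n Q) Q = ∑ Q ∈ S.erase P, φ (n' Q) Q :=
        Finset.sum_congr rfl fun Q hQ => by
          rw [show n' Q = n Q from Function.update_of_ne (Finset.ne_of_mem_erase hQ) ..]
      rw [this]
      ring
    have h1 := hsum (fun a _ => a) (by omega)
    have h2 := hsum (fun a Q => a * Q.degree) (by
      rw [← add_mul, Nat.sub_add_cancel (Nat.one_le_iff_ne_zero.2 hnP)])
    let D' := Function.update D P (D P - 1)
    have hDD' : (fun Q => D Q - n Q) = fun Q => D' Q - n' Q := by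
      funext Q
      by_cases hQ : Q = P
      · subst hQ
        simp only [D', n', Function.update_self]
        omega
      · simp only [D', n', Function.update_of_ne hQ]
    rw [h2, hDD', Nat.cast_add, add_comm]
    have hle1 : D' ≤ D := by
      intro Q
      by_cases hQ : Q = P
      · subst hQ
        simp only [D', Function.update_self]
        omega
      · simp only [D', Function.update_of_ne hQ, le_refl]
    refine le_trans (add_le_add ?_ (ih n' D' (by omega))) (rank_quotient_add_le
      (semilocalSub_mono fun Q => by simp) (semilocalSub_mono hle1))
    rw [one_mul]
    -- An infinite residue field would have degree 0 by convention, so the bound holds in either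
    -- case.
    exact (Cardinal.natCast_toNat_le _).trans (rank_residueField_le S D hP)

end Semilocal

end Place

/-! ### Finiteness of residue fields and of the zeros of a function. -/

namespace IsCurveField

variable {K F : Type*} [Field K] [Field F] [Algebra K F]


theorem essFiniteType (hF : IsCurveField K F) : Algebra.EssFiniteType K F := by
  obtain ⟨w, -, hfin⟩ := hF.exists_transcendental
  have : Algebra.EssFiniteType K K⟮w⟯ :=
    IntermediateField.essFiniteType_iff.2 (by
      simpa using IntermediateField.fg_adjoin_finset (F := K) {w})
  exact Algebra.EssFiniteType.comp K K⟮w⟯ F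

open scoped IntermediateField.algebraAdjoinAdjoin in
-- The transcendence degree is at most 1, so z alone is a transcendence basis and F is algebraic
-- over K(z). Being finitely generated as a field, it is then finite.
theorem finiteDimensional_adjoin (hF : IsCurveField K F) {z : F} (hz : Transcendental K z) :
    FiniteDimensional K⟮z⟯ F := by
  obtain ⟨w, -, hfin⟩ := hF.exists_transcendental
  have hw : Algebra.IsAlgebraic (Algebra.adjoin K {w}) F :=
    Algebra.IsAlgebraic.trans _ K⟮w⟯ _
  have htr : Algebra.trdeg K F ≤ 1 := by
    refine (Algebra.IsAlgebraic.trdeg_le_cardinalMk K ({w} : Set F)).trans ?_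
    simp
  have hind : AlgebraicIndependent K (fun _ : Unit => z) :=
    algebraicIndependent_unique_type_iff.2 hz
  have hbasis := hind.isTranscendenceBasis_of_lift_trdeg_le_of_finite (by simpa using htr)
  have halg : Algebra.IsAlgebraic (Algebra.adjoin K {z}) F := by
    have := hbasis.isAlgebraic
    rwa [Set.range_const] at this
  have halg' : Algebra.IsAlgebraic K⟮z⟯ F := 
    Algebra.IsAlgebraic.extendScalars
      (FaithfulSMul.algebraMap_injective (Algebra.adjoin K {z}) K⟮z⟯)
  have := hF.essFiniteType
  have : Algebra.EssFiniteType K⟮z⟯ F := Algebra.EssFiniteType.of_comp K _ _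
  obtain ⟨s, hs⟩ := IntermediateField.fg_top K⟮z⟯ F
  have hfd := IntermediateField.finiteDimensional_adjoin (K := K⟮z⟯) (S := (s : Set F))
    fun x _ => Algebra.IsIntegral.isIntegral x
  rw [hs] at hfd
  exact IntermediateField.topEquiv.toLinearEquiv.finiteDimensional

theorem transcendental_of_ord_ne_zero (hF : IsCurveField K F) {z : F} (P : Place K F)
    (hz : P.ord z ≠ 0) :
    Transcendental K z := by
  intro h
  obtain ⟨c, rfl⟩ := hF.constants z h
  exact hz (P.ord_algebraMap c)

theorem transcendental_of_notMem_range (hF : IsCurveField K F) {z : F}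
    (hz : ∀ c, algebraMap K F c ≠ z) :
    Transcendental K z := by
  intro h
  obtain ⟨c, hc⟩ := hF.constants z h
  exact hz c hc

theorem ord_eq_zero_of_isAlgebraic (hF : IsCurveField K F) {z : F} (hz : IsAlgebraic K z)
    (P : Place K F) :
    P.ord z = 0 := by
  by_contra h
  exact hF.transcendental_of_ord_ne_zero P h hz

/-- Multiplication by a uniformizer z sends functions regular at P to functions vanishing there, so
the residue field has dimension at most [F : K(z)]. -/
theorem finite_residueField (hF : IsCurveField K F) (P : Place K F) :
    Module.Finite K (IsLocalRing.ResidueField P.ring) := by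
  classical
  have hz : Transcendental K P.unif := hF.transcendental_of_ord_ne_zero P (by rw [P.ord_unif]; simp)
  have := hF.finiteDimensional_adjoin hz
  have h1 := Place.rank_residueField_le {P} (fun _ => 0) (Finset.mem_singleton_self P)
  have h2 := rank_quotient_le_finrank_adjoin hz (Place.semilocalSub {P} fun _ => 0)
    (Place.semilocalSub {P} (Function.update (fun _ => 0) P (0 - 1))) ?_ ?_
  · exact Module.rank_lt_aleph0_iff.1 ((h1.trans h2).trans_lt Cardinal.natCast_lt_aleph0)
  all_goals
    intro f hf
    simp only [Place.mem_semilocalSub, Finset.mem_singleton, forall_eq,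
      Function.update_self] at hf ⊢
    by_cases hf0 : f = 0
    · simp [hf0]
    rw [P.val_eq_exp hf0, exp_le_exp] at hf
    rw [P.val_eq_exp (mul_ne_zero P.unif_ne_zero hf0), P.ord_mul P.unif_ne_zero hf0, P.ord_unif,
      exp_le_exp]
    omega

theorem degree_pos (hF : IsCurveField K F) (P : Place K F) : 0 < P.degree := by
  have := hF.finite_residueField P
  exact Module.finrank_pos

/-- The zeros of `z`, counted with multiplicity, are at most `[F : K(z)]` in number. -/
theorem sum_ord_mul_degree_le (hF : IsCurveField K F) {z : F} (hz : Transcendental K z)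
    (S : Finset (Place K F))
    (hS : ∀ P ∈ S, 0 ≤ P.ord z) :
    ∑ P ∈ S, (P.ord z).toNat * P.degree ≤ Module.finrank K⟮z⟯ F := by
  have := hF.finiteDimensional_adjoin hz
  have hz0 : z ≠ 0 := fun h => hz (h ▸ isAlgebraic_zero)
  -- Both estimates are applied to the functions regular on S modulo those vanishing there at least
  -- as much as z.
  have h1 := Place.sum_degree_le_rank S (fun P => (P.ord z).toNat) (fun _ => 0)
  have h2 := rank_quotient_le_finrank_adjoin hz (Place.semilocalSub S fun _ => 0)
    (Place.semilocalSub S (fun P => 0 - (P.ord z).toNat)) ?_ ?_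
  · exact_mod_cast h1.trans h2
  all_goals
    intro f hf
    rw [Place.mem_semilocalSub] at hf ⊢
    intro P hP
    by_cases hf0 : f = 0
    · simp [hf0]
    have h3 := hf P hP
    have h4 := hS P hP
    rw [P.val_eq_exp hf0, exp_le_exp] at h3
    rw [P.val_eq_exp (mul_ne_zero hz0 hf0), P.ord_mul hz0 hf0, exp_le_exp]
    omega

theorem finite_setOf_ord_pos (hF : IsCurveField K F) (z : F) :
    {P : Place K F | 0 < P.ord z}.Finite := by
  by_cases hz' : IsAlgebraic K z
  · simp [hF.ord_eq_zero_of_isAlgebraic hz']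
  by_contra hinf
  obtain ⟨S, hS, hcard⟩ := Set.Infinite.exists_subset_card_eq hinf (Module.finrank K⟮z⟯ F + 1)
  have h1 := hF.sum_ord_mul_degree_le hz' S fun P hP => (hS hP).le
  have h2 : S.card ≤ ∑ P ∈ S, (P.ord z).toNat * P.degree := by
    rw [Finset.card_eq_sum_ones]
    refine Finset.sum_le_sum fun P hP => ?_
    have h3 : 0 < P.ord z := hS hP
    exact Nat.mul_pos (by omega) (hF.degree_pos P)
  omega

end IsCurveField

/-! ### Existence of places; divisors of poles. -/

namespace IsCurveField

variable {K F : Type*} [Field K] [Field F] [Algebra K F]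

/-- For every nonconstant j in V the quotient V / jV has dimension at most [F : K(j)] over K. An
ideal containing j is therefore finitely generated, and a Noetherian valuation ring that is not a
field is discrete. -/
theorem isDiscreteValuationRing (hF : IsCurveField K F) (V : ValuationSubring F)
    (hK : ∀ c : K, algebraMap K F c ∈ V) (hV : V ≠ ⊤) : IsDiscreteValuationRing V := by
  let _ : Algebra K V := ((algebraMap K F).codRestrict V hK).toAlgebra
  have : IsNoetherianRing V := by
    refine (isNoetherianRing_iff_ideal_fg V).2 fun J => ?_
    by_cases hJ : J = ⊥
    · rw [hJ]
      exact Submodule.fg_bot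
    obtain ⟨j, hjJ, hj0⟩ := (Submodule.ne_bot_iff J).1 hJ
    have hj0' : (j : F) ≠ 0 := fun h => hj0 (Subtype.ext h)
    by_cases hj : IsAlgebraic K (j : F)
    · obtain ⟨c, hc⟩ := hF.constants _ hj
      have : J = ⊤ := by
        refine Ideal.eq_top_of_isUnit_mem J hjJ (IsUnit.of_mul_eq_one
          ⟨algebraMap K F c⁻¹, hK _⟩ (Subtype.ext ?_))
        change (j : F) * algebraMap K F c⁻¹ = 1
        rw [map_inv₀, hc, mul_inv_cancel₀ hj0']
      rw [this]
      exact ⟨{1}, by simp⟩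
    have := hF.finiteDimensional_adjoin hj
    let A : Submodule K F :=
      { V.toSubring.toAddSubgroup.toAddSubmonoid with
        smul_mem' := fun c f hf => by
          rw [Algebra.smul_def]
          exact V.mul_mem _ _ (hK c) hf }
    let B : Submodule K F := A.map (LinearMap.mulLeft K (j : F))
    have hrank := rank_quotient_le_finrank_adjoin hj A B (fun f hf => V.mul_mem _ _ j.2 hf)
      fun f hf => ⟨f, hf, rfl⟩
    have hfin : Module.Finite K (A ⧸ B.submoduleOf A) :=
      Module.rank_lt_aleph0_iff.1 (hrank.trans_lt Cardinal.natCast_lt_aleph0)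
    let g : A →ₗ[K] V ⧸ Ideal.span {j} :=
      { toFun := fun f => Ideal.Quotient.mk _ ⟨f, f.2⟩
        map_add' := fun _ _ => rfl
        map_smul' := fun c f => by
          rw [RingHom.id_apply, Algebra.smul_def]
          refine (congrArg (Ideal.Quotient.mk _) (Subtype.ext ?_)).trans
            (map_mul _ (algebraMap K V c) ⟨f, f.2⟩)
          exact Algebra.smul_def c (f : F) }
    have hfin' : Module.Finite K (V ⧸ Ideal.span {j}) := by
      refine Module.Finite.of_surjective (Submodule.liftQ (B.submoduleOf A) g ?_) ?_
      · rintro f ⟨y, hy, hyf⟩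
        refine Ideal.Quotient.eq_zero_iff_mem.2 (Ideal.mem_span_singleton.2 ⟨⟨y, hy⟩, ?_⟩)
        exact Subtype.ext hyf.symm
      · intro y
        obtain ⟨x, rfl⟩ := Ideal.Quotient.mk_surjective y
        exact ⟨Submodule.Quotient.mk ⟨x, x.2⟩, rfl⟩
    have hnoeth : IsNoetherian V (V ⧸ Ideal.span {j}) :=
      isNoetherian_of_tower K inferInstance
    refine Submodule.fg_of_fg_map_of_fg_inf_ker (Submodule.mkQ (Ideal.span {j}))
      (IsNoetherian.noetherian _) ?_
    rw [Submodule.ker_mkQ, inf_eq_right.2 ((Ideal.span_singleton_le_iff_mem J).2 hjJ)]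
    exact ⟨{j}, by simp [Ideal.span]⟩
  have hfield : ¬ IsField V := by
    intro hfield
    refine hV (eq_top_iff.2 fun f _ => ?_)
    rcases V.mem_or_inv_mem f with h | h
    · exact h
    by_cases hf : f = 0
    · rw [hf]
      exact V.zero_mem
    obtain ⟨g, hg⟩ := hfield.mul_inv_cancel (a := ⟨f⁻¹, h⟩) fun h0 =>
      inv_ne_zero hf (congrArg Subtype.val h0)
    have hg' : f⁻¹ * g = 1 := congrArg Subtype.val hg
    rw [inv_mul_eq_one₀ hf] at hg'
    rw [hg']
    exact g.2
  exact ((IsDiscreteValuationRing.TFAE V hfield).out 1 0).1 (inferInstance : ValuationRing V)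

/-- The place of a curve given by a nontrivial valuation ring containing the constants. -/
def toPlace (hF : IsCurveField K F) (V : ValuationSubring F)
    (hK : ∀ c : K, algebraMap K F c ∈ V) (hV : V ≠ ⊤) : Place K F where
  ring := V
  dvr := hF.isDiscreteValuationRing V hK hV
  algebraMap_mem := hK

/-- The proper ideal (z) of K[z] lies in the nonunits of some valuation ring containing K[z]. That
ring is not F, since z ≠ 0 is not invertible in it. -/
theorem exists_ord_pos (hF : IsCurveField K F) {z : F} (hz : Transcendental K z) :
    ∃ P : Place K F, 0 < P.ord z := by
  have hz0 : z ≠ 0 := fun h => hz (h ▸ isAlgebraic_zero)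
  obtain ⟨hmax, -, -⟩ := adjoin_span_isMaximal hz
  obtain ⟨V, hV, hnon⟩ := Ideal.image_subset_nonunits_valuationSubring
    (A := (Algebra.adjoin K {z}).toSubring) _ hmax.ne_top
  have hzV : z ∈ V.nonunits :=
    hnon ⟨⟨z, Algebra.self_mem_adjoin_singleton K z⟩, Ideal.mem_span_singleton_self _, rfl⟩
  obtain ⟨hzV', hzm⟩ := ValuationSubring.mem_nonunits_iff_exists_mem_maximalIdeal.1 hzV
  have htop : V ≠ ⊤ := by
    rintro rfl
    have h1 : z⁻¹ ∈ (⊤ : ValuationSubring F) := trivial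
    refine hzm (IsUnit.of_mul_eq_one ⟨z⁻¹, h1⟩ (Subtype.ext ?_))
    exact mul_inv_cancel₀ hz0
  refine ⟨hF.toPlace V (fun c => hV (Subalgebra.algebraMap_mem _ c)) htop, ?_⟩
  rw [← Place.val_lt_one_iff _ hz0]
  exact (Place.residue_eq_zero_iff _ ⟨z, hzV'⟩).1 ((IsLocalRing.residue_eq_zero_iff _).2 hzm)

theorem exists_ord_neg (hF : IsCurveField K F) {z : F} (hz : Transcendental K z) :
    ∃ P : Place K F, P.ord z < 0 := by
  have hz' : Transcendental K z⁻¹ := fun h => hz (by simpa using h.inv)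
  obtain ⟨P, hP⟩ := hF.exists_ord_pos hz'
  rw [Place.ord_inv] at hP
  exact ⟨P, by omega⟩

theorem finite_setOf_ord_neg (hF : IsCurveField K F) (z : F) :
    {P : Place K F | P.ord z < 0}.Finite := by
  refine (hF.finite_setOf_ord_pos z⁻¹).subset fun P hP => ?_
  change 0 < P.ord z⁻¹
  rw [Place.ord_inv]
  have : P.ord z < 0 := hP
  omega

/-- The divisor of poles of `z`. -/
def polar (hF : IsCurveField K F) (z : F) : Divisor K F :=
  Finsupp.ofSupportFinite (fun P => max 0 (-P.ord z)) <| by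
    refine (hF.finite_setOf_ord_neg z).subset fun P hP => ?_
    change P.ord z < 0
    rw [Function.mem_support] at hP
    omega

theorem polar_apply (hF : IsCurveField K F) (z : F) (P : Place K F) :
    hF.polar z P = max 0 (-P.ord z) := rfl

theorem polar_nonneg (hF : IsCurveField K F) (z : F) : 0 ≤ hF.polar z :=
  fun _ => le_max_left _ _

end IsCurveField

/-! ### Degrees of divisors and Riemann-Roch spaces. -/

namespace Divisor

variable {K F : Type*} [Field K] [Field F] [Algebra K F]

theorem degree_add (D D' : Divisor K F) : (D + D').degree = D.degree + D'.degree :=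
  Finsupp.sum_add_index' (fun _ => by simp) fun _ _ _ => by ring

/-- The degree as a homomorphism. -/
def degreeHom : Divisor K F →+ ℤ := AddMonoidHom.mk' degree degree_add

theorem degree_sub (D D' : Divisor K F) : (D - D').degree = D.degree - D'.degree :=
  map_sub degreeHom D D'

theorem degree_nsmul (n : ℕ) (D : Divisor K F) : (n • D).degree = n * D.degree :=
  (map_nsmul degreeHom n D).trans (nsmul_eq_mul _ _)

theorem degree_zsmul (n : ℤ) (D : Divisor K F) : (n • D).degree = n * D.degree :=
  (map_zsmul degreeHom n D).trans (zsmul_eq_mul _ _)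

theorem degree_sum {ι : Type*} (s : Finset ι) (D : ι → Divisor K F) :
    (∑ i ∈ s, D i).degree = ∑ i ∈ s, (D i).degree :=
  map_sum degreeHom D s

theorem degree_single (P : Place K F) (a : ℤ) :
    degree (Finsupp.single P a) = a * P.degree :=
  Finsupp.sum_single_index (by simp)

theorem degree_nonneg {D : Divisor K F} (hD : 0 ≤ D) : 0 ≤ D.degree :=
  Finset.sum_nonneg fun P _ => mul_nonneg (hD P) (Int.natCast_nonneg _)

theorem degree_mono {D D' : Divisor K F} (h : D ≤ D') : D.degree ≤ D'.degree := by
  have := degree_nonneg (sub_nonneg.2 h)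
  rw [degree_sub] at this
  linarith

theorem mem_riemannRoch {D : Divisor K F} {f : F} :
    f ∈ D.riemannRoch ↔ ∀ P : Place K F, P.val f ≤ exp (D P) := by
  by_cases hf : f = 0
  · subst hf
    simp
  · simp_rw [← le_ord_iff _ hf]
    exact ⟨fun h => h.resolve_left hf, Or.inr⟩

theorem mem_riemannRoch_iff_ord {D : Divisor K F} {f : F} (hf : f ≠ 0) :
    f ∈ D.riemannRoch ↔ ∀ P : Place K F, 0 ≤ P.ord f + D P :=
  ⟨fun h => h.resolve_left hf, Or.inr⟩

theorem riemannRoch_mono {D D' : Divisor K F} (h : D ≤ D') : D.riemannRoch ≤ D'.riemannRoch :=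
  fun _ hf => mem_riemannRoch.2 fun P => (mem_riemannRoch.1 hf P).trans (exp_le_exp.2 (h P))

theorem mul_mem_riemannRoch {D D' : Divisor K F} {f g : F} (hf : f ∈ D.riemannRoch)
    (hg : g ∈ D'.riemannRoch) : f * g ∈ (D + D').riemannRoch := by
  rw [mem_riemannRoch] at *
  intro P
  rw [map_mul]
  exact mul_le_mul' (hf P) (hg P)

theorem one_mem_riemannRoch_zero : (1 : F) ∈ (0 : Divisor K F).riemannRoch :=
  mem_riemannRoch.2 fun P => by simp

theorem pow_mem_riemannRoch {D : Divisor K F} {f : F} (hf : f ∈ D.riemannRoch) (k : ℕ) :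
    f ^ k ∈ (k • D).riemannRoch := by
  induction k with
  | zero =>
    rw [pow_zero, zero_smul]
    exact one_mem_riemannRoch_zero
  | succ k ih =>
    rw [pow_succ, succ_nsmul]
    exact mul_mem_riemannRoch ih hf

/-- The leading coefficient at P maps L(D) to the residue field with kernel inside L(D - P). -/
theorem rank_riemannRoch_le (D : Divisor K F) (P : Place K F) :
    Module.rank K D.riemannRoch ≤ Module.rank K (IsLocalRing.ResidueField P.ring) +
      Module.rank K (D - Finsupp.single P 1 : Divisor K F).riemannRoch := by
  classical
  let g : D.riemannRoch →ₗ[K] IsLocalRing.ResidueField P.ring :=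
    P.leadingCoeff (D P) ∘ₗ Submodule.inclusion
      (show D.riemannRoch ≤ P.localSub (D P) from fun f hf => mem_riemannRoch.1 hf P)
  rw [← g.rank_range_add_rank_ker]
  refine add_le_add (Submodule.rank_le _) ?_
  have hker : ∀ f : LinearMap.ker g,
      (f : D.riemannRoch).1 ∈ (D - Finsupp.single P 1 : Divisor K F).riemannRoch := by
    rintro ⟨f, hf⟩
    rw [mem_riemannRoch]
    intro Q
    by_cases hQ : P = Q
    · subst hQ
      have := (P.leadingCoeff_eq_zero_iff _ _).1 hf
      simpa [Place.mem_localSub] using this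
    · simpa [Finsupp.single_apply, hQ] using mem_riemannRoch.1 f.2 Q
  refine LinearMap.rank_le_of_injective
    ((D.riemannRoch.subtype ∘ₗ (LinearMap.ker g).subtype).codRestrict _ hker) fun x y hxy => ?_
  have h := congrArg Subtype.val hxy
  exact Subtype.ext (Subtype.ext h)

end Divisor

/-! ### Zeros and poles against the degree [F : K(z)]. -/

namespace IsCurveField

open Divisor

variable {K F : Type*} [Field K] [Field F] [Algebra K F]

theorem mem_riemannRoch_polar (hF : IsCurveField K F) (f : F) : f ∈ (hF.polar f).riemannRoch := by
  by_cases hf : f = 0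
  · exact Or.inl hf
  rw [mem_riemannRoch_iff_ord hf]
  intro P
  rw [polar_apply]
  omega

theorem rank_riemannRoch_zero_le (hF : IsCurveField K F) :
    Module.rank K (0 : Divisor K F).riemannRoch ≤ 1 := by
  have hle : (0 : Divisor K F).riemannRoch ≤ LinearMap.range (Algebra.linearMap K F) := by
    intro f hf
    by_contra h
    have htr : Transcendental K f := hF.transcendental_of_notMem_range fun c hc => h ⟨c, hc⟩
    have hf0 : f ≠ 0 := fun h0 => htr (h0 ▸ isAlgebraic_zero)
    obtain ⟨P, hP⟩ := hF.exists_ord_neg htr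
    have := (mem_riemannRoch_iff_ord hf0).1 hf P
    simp at this
    omega
  refine (Submodule.rank_mono hle).trans ?_
  have := lift_rank_range_le (Algebra.linearMap K F)
  simpa using this

/-- Removing the places of D one at a time loses at most deg P each time and ends at L(0), which
contains only constants because a nonconstant function has a pole. -/
theorem rank_riemannRoch_le_degree_add_one (hF : IsCurveField K F) {D : Divisor K F}
    (hD : 0 ≤ D) : Module.rank K D.riemannRoch ≤ (D.degree.toNat + 1 : ℕ) := by
  classical
  obtain ⟨N, hN⟩ : ∃ N, D.degree.toNat = N := ⟨_, rfl⟩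
  induction N using Nat.strong_induction_on generalizing D with
  | _ N ih =>
    by_cases h0 : D = 0
    · rw [h0]
      refine hF.rank_riemannRoch_zero_le.trans ?_
      exact_mod_cast Nat.le_add_left _ _
    obtain ⟨P, hP⟩ := Finsupp.ne_iff.1 h0
    have hP' : 0 < D P := lt_of_le_of_ne (hD P) (Ne.symm hP)
    have hD' : 0 ≤ D - Finsupp.single P 1 := by
      intro Q
      by_cases hQ : P = Q
      · subst hQ
        simp only [Finsupp.coe_zero, Pi.zero_apply, Finsupp.coe_sub, Pi.sub_apply,
          Finsupp.single_eq_same]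
        omega
      · simpa [Finsupp.single_apply, hQ] using hD Q
    have hdeg : (D - Finsupp.single P 1 : Divisor K F).degree = D.degree - P.degree := by
      rw [degree_sub, degree_single, one_mul]
    have hpos := hF.degree_pos P
    have h1 := degree_nonneg hD'
    have h2 := ih _ (by rw [hdeg]; omega) hD' rfl
    have := hF.finite_residueField P
    refine (rank_riemannRoch_le D P).trans ((add_le_add_right h2 _).trans ?_)
    rw [← Module.finrank_eq_rank, ← Nat.cast_add, Nat.cast_le]
    change P.degree + _ ≤ _
    rw [hdeg] at h1 ⊢
    omega

theorem linearIndependent_gen_pow {z : F} (hz : Transcendental K z) (k : ℕ) :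
    LinearIndependent K fun i : Fin (k + 1) =>
      IntermediateField.AdjoinSimple.gen K z ^ (i : ℕ) := by
  have hz' : Transcendental K (IntermediateField.AdjoinSimple.gen K z) := by
    intro h
    have := h.algebraMap (A := F)
    rw [IntermediateField.AdjoinSimple.algebraMap_gen] at this
    exact hz this
  have h1 := (Polynomial.basisMonomials K).linearIndependent.map'
    (Polynomial.aeval (IntermediateField.AdjoinSimple.gen K z)).toLinearMap
    (LinearMap.ker_eq_bot.2 (transcendental_iff_injective.1 hz'))
  have h2 := h1.comp (fun i : Fin (k + 1) => (i : ℕ)) Fin.val_injective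
  have h3 : ((Polynomial.aeval (IntermediateField.AdjoinSimple.gen K z)).toLinearMap ∘
      Polynomial.basisMonomials K) ∘ (fun i : Fin (k + 1) => (i : ℕ)) =
      fun i : Fin (k + 1) => IntermediateField.AdjoinSimple.gen K z ^ (i : ℕ) := by
    funext i
    simp
  rw [h3] at h2
  exact h2

/-- A nonconstant function `z` has at least `[F : K(z)]` poles, counted with multiplicity. -/
theorem finrank_le_degree_polar (hF : IsCurveField K F) {z : F} (hz : Transcendental K z) :
    (Module.finrank K⟮z⟯ F : ℤ) ≤ (hF.polar z).degree := by
  have := hF.finiteDimensional_adjoin hz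
  let u := Module.finBasis K⟮z⟯ F
  let C : Divisor K F := ∑ j, hF.polar (u j)
  have hC : 0 ≤ C := Finset.sum_nonneg fun j _ => hF.polar_nonneg _
  have hB := degree_nonneg (hF.polar_nonneg z)
  have hC' := degree_nonneg hC
  -- For a basis u of F over K(z), the products z^i u_j with i ≤ k are independent over K and lie in
  -- L(kB + C), where B is the pole divisor of z and C absorbs the poles of u. This is compared with
  -- dim L(kB + C) ≤ deg(kB + C) + 1.
  have key : ∀ k : ℕ, ((k : ℤ) + 1) * Module.finrank K⟮z⟯ F ≤
      k * (hF.polar z).degree + C.degree + 1 := by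
    intro k
    have hli := linearIndependent_smul (linearIndependent_gen_pow hz k) u.linearIndependent
    have hmem : ∀ p : Fin (k + 1) × Fin (Module.finrank K⟮z⟯ F),
        IntermediateField.AdjoinSimple.gen K z ^ (p.1 : ℕ) • u p.2 ∈
          (k • hF.polar z + C).riemannRoch := by
      intro p
      have h1 : IntermediateField.AdjoinSimple.gen K z ^ (p.1 : ℕ) • u p.2 =
        z ^ (p.1 : ℕ) * u p.2 := rfl
      rw [h1]
      refine mul_mem_riemannRoch (riemannRoch_mono ?_
        (pow_mem_riemannRoch (hF.mem_riemannRoch_polar z) p.1))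
        (riemannRoch_mono ?_ (hF.mem_riemannRoch_polar (u p.2)))
      · exact nsmul_le_nsmul_left (hF.polar_nonneg z) (Nat.le_of_lt_succ p.1.2)
      · exact Finset.single_le_sum (f := fun j => hF.polar (u j))
          (fun j _ => hF.polar_nonneg _) (Finset.mem_univ p.2)
    have hli' : LinearIndependent K fun p => (⟨_, hmem p⟩ : (k • hF.polar z + C).riemannRoch) :=
      LinearIndependent.of_comp (k • hF.polar z + C).riemannRoch.subtype hli
    have hle := hli'.cardinal_lift_le_rank.trans (Cardinal.lift_le.2
      (hF.rank_riemannRoch_le_degree_add_one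
        (add_nonneg (nsmul_nonneg (hF.polar_nonneg z) k) hC)))
    simp only [Cardinal.mk_fintype, Fintype.card_prod, Fintype.card_fin, Cardinal.lift_natCast,
      Nat.cast_le, degree_add, degree_nsmul] at hle
    have h3 : 0 ≤ (k : ℤ) * (hF.polar z).degree := by positivity
    zify at hle
    rw [Int.toNat_of_nonneg (by linarith)] at hle
    linarith
  by_contra hlt
  rw [not_le] at hlt
  -- If deg B ≤ [F : K(z)] - 1, the inequality gives k + [F : K(z)] ≤ deg C + 1, which this k
  -- violates.
  have h := key (C.degree.toNat + 2)
  push_cast at h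
  rw [Int.toNat_of_nonneg hC'] at h
  nlinarith

/-- The zeros of `z`, counted with multiplicity, are at most `[F : K(z)]` in number. -/
theorem degree_polar_inv_le (hF : IsCurveField K F) {z : F} (hz : Transcendental K z) :
    (hF.polar z⁻¹).degree ≤ (Module.finrank K⟮z⟯ F : ℤ) := by
  have hS : ∀ P ∈ (hF.polar z⁻¹).support, 0 < P.ord z := by
    intro P hP
    rw [Finsupp.mem_support_iff, polar_apply, Place.ord_inv] at hP
    omega
  have h := hF.sum_ord_mul_degree_le hz _ fun P hP => (hS P hP).le
  refine le_trans (le_of_eq ?_) (Int.ofNat_le.2 h)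
  push_cast
  refine Finset.sum_congr rfl fun P hP => ?_
  have := hS P hP
  rw [polar_apply, Place.ord_inv, Int.toNat_of_nonneg this.le]
  congr 1
  omega

theorem degree_polar_le (hF : IsCurveField K F) {z : F} (hz : Transcendental K z) :
    (hF.polar z).degree ≤ (Module.finrank K⟮z⟯ F : ℤ) := by
  have hz' : Transcendental K z⁻¹ := fun h => hz (by simpa using h.inv)
  have h := hF.degree_polar_inv_le hz'
  have hK : K⟮z⁻¹⟯ = K⟮z⟯ := by
    refine le_antisymm ?_ ?_ <;> rw [IntermediateField.adjoin_simple_le_iff]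
    · exact inv_mem (IntermediateField.mem_adjoin_simple_self K z)
    · simpa using inv_mem (IntermediateField.mem_adjoin_simple_self K z⁻¹)
  rwa [inv_inv, hK] at h

/-- D dominates the poles of f minus its zeros. For nonconstant f the former have degree at least [F
: K(f)] and the latter at most that; a constant has neither. -/
theorem degree_nonneg_of_mem_riemannRoch (hF : IsCurveField K F) {D : Divisor K F} {f : F}
    (hf : f ≠ 0) (hfD : f ∈ D.riemannRoch) : 0 ≤ D.degree := by
  rw [mem_riemannRoch_iff_ord hf] at hfD
  by_cases halg : IsAlgebraic K f
  · refine degree_nonneg fun P => ?_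
    have := hfD P
    rwa [hF.ord_eq_zero_of_isAlgebraic halg, zero_add] at this
  have h1 := hF.finrank_le_degree_polar halg
  have h2 := hF.degree_polar_inv_le halg
  have h3 : hF.polar f - hF.polar f⁻¹ ≤ D := by
    intro P
    have := hfD P
    rw [Finsupp.sub_apply, polar_apply, polar_apply, Place.ord_inv]
    omega
  have h4 := degree_mono h3
  rw [degree_sub] at h4
  linarith

end IsCurveField

/-! ### Places in a finite extension, ramification and pullback of divisors. -/

namespace Place

variable {K E F : Type*} [Field K] [Field E] [Field F] [Algebra K E] [Algebra K F] [Algebra E F]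
  {Q : Place K F} {P P' : Place K E}

theorem LiesOver.unique (h : Q.LiesOver P) (h' : Q.LiesOver P') : P = P' :=
  Place.ext (h.symm.trans h')

theorem LiesOver.mem_ring_iff (h : Q.LiesOver P) (f : E) :
    algebraMap E F f ∈ Q.ring ↔ f ∈ P.ring := by
  rw [← (show Q.ring.comap (algebraMap E F) = P.ring from h), ValuationSubring.mem_comap]

theorem LiesOver.ord_nonneg_iff (h : Q.LiesOver P) {f : E} (hf : f ≠ 0) :
    0 ≤ Q.ord (algebraMap E F f) ↔ 0 ≤ P.ord f := by
  have hf' : algebraMap E F f ≠ 0 := by simpa using hf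
  have h1 := h.mem_ring_iff f
  rw [Place.mem_ring_iff, Place.mem_ring_iff, Q.val_eq_exp hf', P.val_eq_exp hf, ← exp_zero,
    exp_le_exp, exp_le_exp] at h1
  omega

theorem LiesOver.ord_pos_iff (h : Q.LiesOver P) {f : E} (hf : f ≠ 0) :
    0 < Q.ord (algebraMap E F f) ↔ 0 < P.ord f := by
  have h1 := h.ord_nonneg_iff (inv_ne_zero hf)
  rw [map_inv₀, ord_inv, ord_inv] at h1
  omega

theorem ord_zpow (f : E) (n : ℤ) : P.ord (f ^ n) = n * P.ord f := by
  rw [ord, ord, map_zpow₀, log_zpow]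
  simp

/-- The order of a function of `E` at a place `Q` over `P` is its order at `P` times the
ramification index. -/
theorem LiesOver.ord_eq (h : Q.LiesOver P) {f : E} (hf : f ≠ 0) :
    Q.ord (algebraMap E F f) = Q.ord (algebraMap E F P.unif) * P.ord f := by
  -- Dividing f by a power of the uniformizer leaves a unit at P, which stays a unit at Q.
  have hz : P.unif ^ (-P.ord f) ≠ 0 := zpow_ne_zero _ P.unif_ne_zero
  have hu : P.ord (f * P.unif ^ (-P.ord f)) = 0 := by
    rw [ord_mul _ hf hz, ord_zpow, ord_unif]
    ring
  have h1 := h.ord_nonneg_iff (mul_ne_zero hf hz)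
  have h2 := h.ord_pos_iff (mul_ne_zero hf hz)
  have h3 : Q.ord (algebraMap E F (f * P.unif ^ (-P.ord f))) = 0 := by omega
  rw [map_mul, ord_mul _ (by simpa using hf) ((map_ne_zero _).2 hz), map_zpow₀, ord_zpow] at h3
  linarith

theorem LiesOver.ramification_pos (h : Q.LiesOver P) : 0 < Q.ord (algebraMap E F P.unif) :=
  (h.ord_pos_iff P.unif_ne_zero).2 (by rw [ord_unif]; exact one_pos)

theorem span_unif {R : Place K E} (hR : R.unif ∈ R.ring) :
    Ideal.span {(⟨R.unif, hR⟩ : R.ring)} = IsLocalRing.maximalIdeal R.ring := by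
  ext x
  rw [← IsLocalRing.residue_eq_zero_iff, residue_eq_zero_iff, Ideal.mem_span_singleton]
  constructor
  · rintro ⟨y, rfl⟩
    have hy := (R.mem_ring_iff _).1 y.2
    change R.val (R.unif * y) < 1
    rw [map_mul]
    refine (mul_le_of_le_one_right zero_le hy).trans_lt ?_
    rw [val_unif, ← exp_zero, exp_lt_exp]
    omega
  · intro hx
    refine ⟨⟨R.unif⁻¹ * x, ?_⟩, Subtype.ext (mul_inv_cancel_left₀ R.unif_ne_zero _).symm⟩
    by_cases hx0 : (x : E) = 0
    · rw [hx0, mul_zero]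
      exact zero_mem _
    rw [val_lt_one_iff _ hx0] at hx
    rw [Place.mem_ring_iff, val_eq_exp _ (mul_ne_zero (inv_ne_zero R.unif_ne_zero) hx0),
      ord_mul _ (inv_ne_zero R.unif_ne_zero) hx0, ord_inv, ord_unif, ← exp_zero, exp_le_exp]
    omega

end Place

namespace IsCurveField

open Divisor Place

variable {K E F : Type*} [Field K] [Field E] [Field F] [Algebra K E] [Algebra K F] [Algebra E F]

open Classical in
/-- The fibre of the map of curves given by `E ⊆ F` over the point `P`, with multiplicities. -/
def fiber (hF : IsCurveField K F) (P : Place K E) : Divisor K F :=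
  Finsupp.ofSupportFinite
    (fun Q => if Q.LiesOver P then Q.ord (algebraMap E F P.unif) else 0) <| by
    refine (hF.finite_setOf_ord_pos (algebraMap E F P.unif)).subset fun Q hQ => ?_
    rw [Function.mem_support] at hQ
    by_cases h : Q.LiesOver P
    · exact h.ramification_pos
    · simp [h] at hQ

theorem fiber_apply (hF : IsCurveField K F) {P : Place K E} {Q : Place K F} (h : Q.LiesOver P) :
    hF.fiber P Q = Q.ord (algebraMap E F P.unif) := if_pos h

theorem fiber_apply_of_not (hF : IsCurveField K F) {P : Place K E} {Q : Place K F}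
    (h : ¬ Q.LiesOver P) : hF.fiber P Q = 0 := if_neg h

/-- The pullback of a divisor along the map of curves given by `E ⊆ F`. -/
def pullback (hF : IsCurveField K F) (D : Divisor K E) : Divisor K F :=
  ∑ P ∈ D.support, D P • hF.fiber P

theorem pullback_apply (hF : IsCurveField K F) (D : Divisor K E) {P : Place K E} {Q : Place K F}
    (h : Q.LiesOver P) : hF.pullback D Q = D P * Q.ord (algebraMap E F P.unif) := by
  rw [pullback, Finsupp.finsetSum_apply, Finset.sum_eq_single P]
  · rw [Finsupp.smul_apply, hF.fiber_apply h, smul_eq_mul]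
  · intro P' _ hne
    rw [Finsupp.smul_apply, hF.fiber_apply_of_not fun h' => hne (h'.unique h), smul_zero]
  · intro hP
    rw [Finsupp.notMem_support_iff.1 hP, zero_smul, Finsupp.zero_apply]

variable [IsScalarTower K E F]

/-- The contraction of the ring of Q is a place unless it is all of E. In that case F would be
integral over the ring of Q, which is integrally closed and would contain the inverse of its
uniformizer. -/
theorem exists_liesOver (hE : IsCurveField K E) [FiniteDimensional E F] (Q : Place K F) :
    ∃ P : Place K E, Q.LiesOver P := by
  have hK : ∀ c : K, algebraMap K E c ∈ Q.ring.comap (algebraMap E F) := by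
    intro c
    rw [ValuationSubring.mem_comap, ← IsScalarTower.algebraMap_apply]
    exact Q.algebraMap_mem c
  refine ⟨hE.toPlace _ hK fun htop => ?_, rfl⟩
  have hEQ : ∀ a : E, algebraMap E F a ∈ Q.ring := by
    intro a
    rw [← ValuationSubring.mem_comap, htop]
    trivial
  let _ : Algebra E Q.ring := ((algebraMap E F).codRestrict Q.ring hEQ).toAlgebra
  have : IsScalarTower E Q.ring F := IsScalarTower.of_algebraMap_eq fun _ => rfl
  have hint : IsIntegral Q.ring Q.unif⁻¹ :=
    (Algebra.IsIntegral.isIntegral (R := E) Q.unif⁻¹).tower_top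
  obtain ⟨y, hy⟩ := IsIntegrallyClosed.isIntegral_iff.1 hint
  have h := (Q.mem_ring_iff _).1 y.2
  rw [show (y : F) = Q.unif⁻¹ from hy, map_inv₀, val_unif, ← exp_neg, ← exp_zero, exp_le_exp] at h
  omega

/-- The fundamental inequality `∑ e f ≤ [F : E]` for the places over `P`. -/
theorem sum_ramification_mul_degree_le (hE : IsCurveField K E) [FiniteDimensional E F]
    (P : Place K E) (S : Finset (Place K F)) (hS : ∀ Q ∈ S, Q.LiesOver P) :
    ∑ Q ∈ S, (Q.ord (algebraMap E F P.unif)).toNat * Q.degree ≤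
      Module.finrank E F * P.degree := by
  have hunif : P.unif ∈ P.ring := by
    rw [Place.mem_ring_iff, val_unif, ← exp_zero, exp_le_exp]
    omega
  let _ : Algebra P.ring F := ((algebraMap E F).comp (algebraMap P.ring E)).toAlgebra
  have : IsScalarTower P.ring E F := IsScalarTower.of_algebraMap_eq fun _ => rfl
  have : IsScalarTower K P.ring F := IsScalarTower.of_algebraMap_eq fun c =>
    IsScalarTower.algebraMap_apply K E F c
  have hinj : Function.Injective (algebraMap P.ring F) :=
    (algebraMap E F).injective.comp Subtype.val_injective
  have : FaithfulSMul P.ring F := (faithfulSMul_iff_algebraMap_injective _ _).2 hinj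
  have hspan := span_unif hunif
  have hmax : (Ideal.span {(⟨P.unif, hunif⟩ : P.ring)}).IsMaximal := by
    rw [hspan]
    exact IsLocalRing.maximalIdeal.isMaximal _
  have hfin : Module.Finite K (P.ring ⧸ Ideal.span {(⟨P.unif, hunif⟩ : P.ring)}) := by
    rw [hspan]
    exact hE.finite_residueField P
  have hdeg : Module.finrank K (P.ring ⧸ Ideal.span {(⟨P.unif, hunif⟩ : P.ring)}) = P.degree := by
    rw [hspan]
    rfl
  have hn : Module.rank P.ring F ≤ (Module.finrank E F : ℕ) := by
    rw [Module.finrank_eq_rank]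
    exact (IsLocalization.rank_eq E (nonZeroDivisors P.ring) le_rfl).ge
  have h0 : algebraMap E F P.unif ≠ 0 := by simpa using P.unif_ne_zero
  -- The two estimates again, now over the ring of P with its uniformizer as prime element; F has
  -- rank [F : E] over that ring.
  have h1 := Place.sum_degree_le_rank S (fun Q => (Q.ord (algebraMap E F P.unif)).toNat)
    (fun _ => 0)
  have h2 := rank_quotient_le (K := K) (M := F) (R := P.ring)
    (fun h => P.unif_ne_zero (congrArg Subtype.val h)) hmax hn
    (Place.semilocalSub S fun _ => 0)
    (Place.semilocalSub S fun Q => 0 - (Q.ord (algebraMap E F P.unif)).toNat) ?_ ?_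
  · rw [hdeg] at h2
    exact_mod_cast h1.trans h2
  · intro a f hf
    rw [Place.mem_semilocalSub] at hf ⊢
    intro Q hQ
    have ha := (Q.mem_ring_iff _).1 (((hS Q hQ).mem_ring_iff a.1).2 a.2)
    rw [show a • f = algebraMap E F a * f from Algebra.smul_def a f, map_mul]
    exact (mul_le_of_le_one_left zero_le ha).trans (hf Q hQ)
  · intro f hf
    rw [Place.mem_semilocalSub] at hf ⊢
    intro Q hQ
    rw [show (⟨P.unif, hunif⟩ : P.ring) • f = algebraMap E F P.unif * f from
      Algebra.smul_def (⟨P.unif, hunif⟩ : P.ring) f]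
    by_cases hf0 : f = 0
    · simp [hf0]
    have h3 := hf Q hQ
    have h4 := (hS Q hQ).ramification_pos
    rw [Q.val_eq_exp hf0, exp_le_exp] at h3
    rw [Q.val_eq_exp (mul_ne_zero h0 hf0), Q.ord_mul h0 hf0, exp_le_exp]
    omega

theorem degree_fiber_le (hE : IsCurveField K E) (hF : IsCurveField K F) [FiniteDimensional E F]
    (P : Place K E) : (hF.fiber P).degree ≤ Module.finrank E F * P.degree := by
  have hS : ∀ Q ∈ (hF.fiber P).support, Q.LiesOver P := by
    intro Q hQ
    by_contra h
    exact Finsupp.mem_support_iff.1 hQ (hF.fiber_apply_of_not h)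
  have h := hE.sum_ramification_mul_degree_le P _ hS
  refine le_trans (le_of_eq ?_) ((Int.ofNat_le.2 h).trans_eq (by push_cast; rfl))
  push_cast
  refine Finset.sum_congr rfl fun Q hQ => ?_
  rw [hF.fiber_apply (hS Q hQ), Int.toNat_of_nonneg (hS Q hQ).ramification_pos.le]

/-- Effectivity lets the inequality for single fibres be summed, so equality ∑ e f = [F : E] is not
needed. -/
theorem degree_pullback_le (hE : IsCurveField K E) (hF : IsCurveField K F)
    [FiniteDimensional E F] {D : Divisor K E} (hD : 0 ≤ D) :
    (hF.pullback D).degree ≤ Module.finrank E F * D.degree := by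
  rw [pullback, degree_sum, Divisor.degree, Finsupp.sum, Finset.mul_sum]
  refine Finset.sum_le_sum fun P _ => ?_
  rw [degree_zsmul, mul_left_comm]
  exact mul_le_mul_of_nonneg_left (hE.degree_fiber_le hF P) (hD P)

theorem algebraMap_mem_riemannRoch_pullback (hE : IsCurveField K E) (hF : IsCurveField K F)
    [FiniteDimensional E F] {D : Divisor K E} {f : E} (hf : f ∈ D.riemannRoch) :
    algebraMap E F f ∈ (hF.pullback D).riemannRoch := by
  by_cases hf0 : f = 0
  · rw [hf0, map_zero]
    exact Submodule.zero_mem _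
  rw [mem_riemannRoch_iff_ord (by simpa using hf0)]
  rw [mem_riemannRoch_iff_ord hf0] at hf
  intro Q
  obtain ⟨P, hP⟩ := hE.exists_liesOver Q
  rw [hP.ord_eq hf0, hF.pullback_apply D hP, mul_comm, ← add_mul]
  exact mul_nonneg (hf P) hP.ramification_pos.le

end IsCurveField

/-! ### Values at rational points, and the bound by gonality. -/

namespace Place

variable {K F : Type*} [Field K] [Field F] [Algebra K F] {P : Place K F}

theorem IsRational.hasValue_eval (hP : P.IsRational) {f : F} (hf : f ∈ P.ring) :
    P.HasValue f (P.eval f) := by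
  have hbot := Subalgebra.bot_eq_top_of_finrank_eq_one
    (show Module.finrank K (IsLocalRing.ResidueField P.ring) = 1 from hP)
  obtain ⟨c, hc⟩ := Algebra.mem_bot.1 (hbot ▸ Algebra.mem_top :
    IsLocalRing.residue P.ring ⟨f, hf⟩ ∈ (⊥ : Subalgebra K (IsLocalRing.ResidueField P.ring)))
  have hval : P.HasValue f c := by
    have h : IsLocalRing.residue P.ring (⟨f, hf⟩ - algebraMap K P.ring c) = 0 := by
      rw [map_sub, sub_eq_zero, ← hc]
      rfl
    exact (P.residue_eq_zero_iff _).1 h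
  rw [hval.eval_eq]
  exact hval

theorem HasValue.add {f g : F} {c d : K} (hf : P.HasValue f c) (hg : P.HasValue g d) :
    P.HasValue (f + g) (c + d) := by
  have h := P.val.map_add (f - algebraMap K F c) (g - algebraMap K F d)
  rw [sub_add_sub_comm, ← map_add] at h
  exact h.trans_lt (max_lt hf hg)

theorem HasValue.smul {f : F} {c : K} (hf : P.HasValue f c) (a : K) :
    P.HasValue (a • f) (a * c) := by
  rw [HasValue, map_mul, Algebra.smul_def, ← mul_sub, map_mul]
  exact (mul_le_of_le_one_left zero_le ((P.mem_ring_iff _).1 (P.algebraMap_mem a))).trans_lt hf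

theorem mem_localSub_zero {f : F} : f ∈ P.localSub 0 ↔ f ∈ P.ring := by
  rw [mem_localSub, exp_zero, mem_ring_iff]

end Place

namespace IsCurveField

open Divisor

variable {K F : Type*} [Field K] [Field F] [Algebra K F]

/-- Since v ≥ 1, L(R) has a nonzero element, so deg R ≥ 0 and R competes in an infimum over natural
numbers. -/
theorem gonality_le_degree (hF : IsCurveField K F) {R : Divisor K F} {v : ℕ} (hv : 1 ≤ v)
    (hR : (v : Cardinal) ≤ Module.rank K R.riemannRoch) :
    (gonality K F (v - 1) : ℤ) ≤ R.degree := by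
  have hpos : 0 < Module.rank K R.riemannRoch :=
    lt_of_lt_of_le (by exact_mod_cast hv) hR
  have : Nontrivial R.riemannRoch := rank_pos_iff_nontrivial.1 hpos
  obtain ⟨f, hf⟩ := exists_ne (0 : R.riemannRoch)
  have hdeg := hF.degree_nonneg_of_mem_riemannRoch (fun h => hf (Subtype.ext h)) f.2
  rw [← Int.toNat_of_nonneg hdeg, Nat.cast_le]
  exact Nat.sInf_le ⟨R, (Int.toNat_of_nonneg hdeg).symm, by rwa [Nat.sub_add_cancel hv]⟩

end IsCurveField

/-! ### The code and its generalized weights. -/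

namespace LRCData

open Divisor Place

variable {K E F : Type*} [Field K] [Field E] [Field F] [Algebra K E] [Algebra K F] [Algebra E F]
  (A : LRCData K E F)

/-- The functions which are regular at all the points `P i j`. -/
def regularSub : Submodule K F := ⨅ p : Fin (A.r + 1) × Fin A.s, (A.point p.1 p.2).localSub 0

theorem mem_regularSub {f : F} : f ∈ A.regularSub ↔
    ∀ p : Fin (A.r + 1) × Fin A.s, f ∈ (A.point p.1 p.2).ring := by
  simp_rw [regularSub, Submodule.mem_iInf, mem_localSub_zero]

/-- `eval` defaults to 0 where no value exists. On regular functions the value is genuine, and its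
uniqueness makes evaluation linear. -/
theorem hasValue_ev {f : F} (hf : f ∈ A.regularSub) (p : Fin (A.r + 1) × Fin A.s) :
    (A.point p.1 p.2).HasValue f (A.ev f p) :=
  (A.point_rational p.1 p.2).hasValue_eval (A.mem_regularSub.1 hf p)

/-- The evaluation at the points `P i j` as a linear map. -/
def evLinear : A.regularSub →ₗ[K] (Fin (A.r + 1) × Fin A.s → K) where
  toFun f := A.ev f
  map_add' f g := funext fun p =>
    ((A.hasValue_ev f.2 p).add (A.hasValue_ev g.2 p)).eval_eq
  map_smul' c f := funext fun p => ((A.hasValue_ev f.2 p).smul c).eval_eq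

/-- The divisor `t g^* Q_∞ + (r - 1) (x)_∞`. -/
def poleDivisor (hF : IsCurveField K F) : Divisor K F :=
  hF.pullback (A.t • A.Qinf) + (A.r - 1) • hF.polar A.x

/-- Functions in L(G) are therefore regular at the evaluation points, and vanishing at such a point
means exactly lowering G there from 0 to -1. -/
theorem poleDivisor_point (hF : IsCurveField K F) (i : Fin (A.r + 1)) (j : Fin A.s) :
    A.poleDivisor hF (A.point i j) = 0 := by
  have hx : max 0 (-(A.point i j).ord A.x) = 0 := by
    by_cases h0 : A.x = 0
    · simp [h0, ord_zero]
    have := (mem_localSub_iff_ord _ h0).1 (mem_localSub_zero.2 (A.x_regular i j))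
    omega
  rw [poleDivisor, Finsupp.add_apply, hF.pullback_apply _ (A.point_liesOver i j),
    Finsupp.smul_apply, Finsupp.smul_apply, Finsupp.notMem_support_iff.1 (A.Qinf_disjoint j),
    hF.polar_apply, hx]
  simp

theorem riemannRoch_poleDivisor_le (hF : IsCurveField K F) :
    (A.poleDivisor hF).riemannRoch ≤ A.regularSub := by
  intro f hf
  refine A.mem_regularSub.2 fun p => mem_localSub_zero.1 ?_
  have := mem_riemannRoch.1 hf (A.point p.1 p.2)
  rwa [A.poleDivisor_point] at this

theorem finiteDimensional (A : LRCData K E F) : FiniteDimensional E F :=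
  Module.finite_of_finrank_pos (by rw [A.finrank_eq]; exact Nat.succ_pos _)

/-- The divisor of functions in `L(D)` which moreover vanish at the points indexed by `Z`. -/
def vanishingDivisor (D : Divisor K F) (Z : Finset (Fin (A.r + 1) × Fin A.s)) : Divisor K F :=
  D - ∑ p ∈ Z, Finsupp.single (A.point p.1 p.2) 1

theorem degree_vanishingDivisor (D : Divisor K F) (Z : Finset (Fin (A.r + 1) × Fin A.s)) :
    (A.vanishingDivisor D Z).degree = D.degree - Z.card := by
  rw [vanishingDivisor, degree_sub, degree_sum, Finset.card_eq_sum_ones]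
  push_cast
  congr 1
  refine Finset.sum_congr rfl fun p _ => ?_
  rw [degree_single, show (A.point p.1 p.2).degree = 1 from A.point_rational p.1 p.2]
  simp

theorem mem_riemannRoch_vanishingDivisor (hF : IsCurveField K F)
    {Z : Finset (Fin (A.r + 1) × Fin A.s)} {f : F} (hf : f ∈ (A.poleDivisor hF).riemannRoch)
    (hZ : ∀ p ∈ Z, A.ev f p = 0) :
    f ∈ (A.vanishingDivisor (A.poleDivisor hF) Z).riemannRoch := by
  classical
  rw [mem_riemannRoch]
  intro Q
  rw [vanishingDivisor, Finsupp.sub_apply, Finsupp.finsetSum_apply]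
  by_cases hQ : ∃ p ∈ Z, A.point p.1 p.2 = Q
  · obtain ⟨p, hp, rfl⟩ := hQ
    rw [Finset.sum_eq_single p, Finsupp.single_eq_same, A.poleDivisor_point,
      val_le_exp_sub_one_iff, exp_zero]
    · have h := A.hasValue_ev (A.riemannRoch_poleDivisor_le hF hf) p
      rwa [hZ p hp, HasValue, map_zero, sub_zero] at h
    · intro q _ hq
      refine Finsupp.single_eq_of_ne fun h => hq ?_
      obtain ⟨h1, h2⟩ := A.point_injective h
      exact Prod.ext h1.symm h2.symm
    · exact fun h => absurd hp h
  · rw [Finset.sum_eq_zero, sub_zero]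
    · exact mem_riemannRoch.1 hf Q
    · intro p hp
      refine Finsupp.single_eq_of_ne fun h => hQ ⟨p, hp, h.symm⟩

/-- The infimum of an empty set would be 0; v ≤ dim C supplies a subcode, so the minimum is
attained. -/
theorem exists_subcode {v : ℕ} (hv : v ≤ Module.finrank K A.code) :
    ∃ C ≤ A.code, Module.finrank K C = v ∧
      (codeSupport C).ncard = genHammingWeight A.code v := by
  have hne : {w : ℕ | ∃ D : Submodule K (Fin (A.r + 1) × Fin A.s → K), D ≤ A.code ∧
      Module.finrank K D = v ∧ (codeSupport D).ncard = w}.Nonempty := by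
    obtain ⟨c, hc⟩ := exists_linearIndependent_of_le_finrank hv
    have hc' := hc.map' A.code.subtype (Submodule.ker_subtype _)
    refine ⟨_, Submodule.span K (Set.range (A.code.subtype ∘ c)), ?_, ?_, rfl⟩
    · rw [Submodule.span_le]
      rintro _ ⟨i, rfl⟩
      exact (c i).2
    · rw [finrank_span_eq_card hc', Fintype.card_fin]
  exact Nat.sInf_mem hne

variable [IsScalarTower K E F]

theorem mul_pow_mem_riemannRoch (hE : IsCurveField K E) (hF : IsCurveField K F)
    (p : Fin A.r × Fin A.m) :
    algebraMap E F (A.f p.2 : E) * A.x ^ (p.1 : ℕ) ∈ (A.poleDivisor hF).riemannRoch := by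
  have := A.finiteDimensional
  refine mul_mem_riemannRoch (hE.algebraMap_mem_riemannRoch_pullback hF (A.f p.2).2)
    (riemannRoch_mono ?_ (pow_mem_riemannRoch (hF.mem_riemannRoch_polar A.x) p.1))
  exact nsmul_le_nsmul_left (hF.polar_nonneg _) (by omega)

/-- A constant x would generate only E, forcing r + 1 = 1. -/
theorem transcendental_x (hF : IsCurveField K F) (hr : A.r ≠ 0) : Transcendental K A.x := by
  refine hF.transcendental_of_notMem_range fun c hc => hr ?_
  have hbot : E⟮A.x⟯ = ⊥ := by
    rw [IntermediateField.adjoin_simple_eq_bot_iff, IntermediateField.mem_bot]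
    exact ⟨algebraMap K E c, by rw [← hc, ← IsScalarTower.algebraMap_apply]⟩
  have h := IntermediateField.bot_eq_top_iff_finrank_eq_one.1 (hbot.symm.trans A.adjoin_x)
  rw [A.finrank_eq] at h
  omega

theorem degree_poleDivisor_le (hE : IsCurveField K E) (hF : IsCurveField K F) (hr : A.r ≠ 0) :
    (A.poleDivisor hF).degree ≤ A.t * A.ell * (A.r + 1) + ((A.r : ℤ) - 1) * A.h := by
  have := A.finiteDimensional
  have h1 := hE.degree_pullback_le hF A.D_effective
  have h2 := hF.degree_polar_le (A.transcendental_x hF hr)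
  rw [A.finrank_eq, degree_nsmul] at h1
  have h3 : ((A.r - 1 : ℕ) : ℤ) = (A.r : ℤ) - 1 := by omega
  rw [poleDivisor, degree_add, degree_nsmul, h3]
  have h4 := mul_le_mul_of_nonneg_left h2 (show 0 ≤ (A.r : ℤ) - 1 by omega)
  rw [ell, h]
  push_cast at h1
  linarith

theorem exists_submodule_of_subcode (hE : IsCurveField K E) (hF : IsCurveField K F)
    {C : Submodule K (Fin (A.r + 1) × Fin A.s → K)} (hC : C ≤ A.code) :
    ∃ W : Submodule K A.regularSub,
      W.map A.evLinear = C ∧ ∀ u ∈ W, (u : F) ∈ (A.poleDivisor hF).riemannRoch := by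
  let u : Fin A.r × Fin A.m → A.regularSub := fun p =>
    ⟨_, A.riemannRoch_poleDivisor_le hF (A.mul_pow_mem_riemannRoch hE hF p)⟩
  have hcode : A.code = (Submodule.span K (Set.range u)).map A.evLinear := by
    rw [Submodule.map_span, ← Set.range_comp]
    rfl
  -- The full preimage of C in the span of the f_j x^i: it maps onto C whether or not evaluation is
  -- injective.
  refine ⟨Submodule.span K (Set.range u) ⊓ C.comap A.evLinear, ?_, fun w hw => ?_⟩
  · rw [← Submodule.map_inf_eq_map_inf_comap, ← hcode, inf_eq_right.2 hC]
  · have hle : Submodule.span K (Set.range u) ≤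
        (A.poleDivisor hF).riemannRoch.comap A.regularSub.subtype := by
      rw [Submodule.span_le]
      rintro _ ⟨p, rfl⟩
      exact A.mul_pow_mem_riemannRoch hE hF p
    exact hle hw.1

theorem le_genHammingWeight (hE : IsCurveField K E) (hF : IsCurveField K F) {v : ℕ} (hv : 1 ≤ v)
    (hvk : v ≤ Module.finrank K A.code) :
    (A.n : ℤ) - A.t * A.ell * (A.r + 1) - ((A.r : ℤ) - 1) * A.h + (gonality K F (v - 1) : ℤ) ≤
      (genHammingWeight A.code v : ℤ) := by
  classical
  -- For r = 0 there are no generators, so the code is 0 and v ≥ 1 is impossible.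
  have hr : A.r ≠ 0 := by
    intro hr
    have : IsEmpty (Fin A.r × Fin A.m) := by
      rw [hr]
      infer_instance
    rw [code, Set.range_eq_empty, Submodule.span_empty, finrank_bot] at hvk
    omega
  obtain ⟨C, hC, hCv, hCw⟩ := A.exists_subcode hvk
  obtain ⟨W, hWC, hW⟩ := A.exists_submodule_of_subcode hE hF hC
  -- The n - d_v coordinates at which every word of C is zero.
  let Z : Finset (Fin (A.r + 1) × Fin A.s) := (codeSupport C).toFinsetᶜ
  have hWR : ∀ u : W, (u : A.regularSub).1 ∈
      (A.vanishingDivisor (A.poleDivisor hF) Z).riemannRoch := by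
    intro u
    refine A.mem_riemannRoch_vanishingDivisor hF (hW u u.2) fun p hp => ?_
    rw [Finset.mem_compl, Set.mem_toFinset] at hp
    by_contra h
    exact hp ⟨A.evLinear u, hWC ▸ Submodule.mem_map_of_mem u.2, h⟩
  have hrank : (v : Cardinal) ≤
      Module.rank K (A.vanishingDivisor (A.poleDivisor hF) Z).riemannRoch := by
    have h1 : Module.rank K W ≤
        Module.rank K (A.vanishingDivisor (A.poleDivisor hF) Z).riemannRoch := by
      refine LinearMap.rank_le_of_injective
        ((A.regularSub.subtype ∘ₗ W.subtype).codRestrict _ hWR) fun u w huw => ?_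
      have h := congrArg Subtype.val huw
      exact Subtype.ext (Subtype.ext h)
    have h2 := lift_rank_map_le A.evLinear W
    rw [hWC, ← Module.finrank_eq_rank, hCv, Cardinal.lift_natCast] at h2
    exact (Cardinal.nat_le_lift_iff.1 h2).trans h1
  have hgon := hF.gonality_le_degree hv hrank
  have hdeg := A.degree_poleDivisor_le hE hF hr
  have hZ : (Z.card : ℤ) = A.n - genHammingWeight A.code v := by
    rw [← hCw, Set.ncard_eq_toFinset_card', Finset.card_compl, Nat.cast_sub (Finset.card_le_univ _),
      Fintype.card_prod, Fintype.card_fin, Fintype.card_fin, n]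
  rw [A.degree_vanishingDivisor, hZ] at hgon
  linarith

end LRCData

end AGCode

end

theorem theorem3p2 {K E F : Type*} [Field K] [Finite K] [Field E] [Field F]
    [Algebra K E] [Algebra K F] [Algebra E F] [IsScalarTower K E F]
    (hE : AGCode.IsCurveField K E) (hF : AGCode.IsCurveField K F)
    (A : AGCode.LRCData K E F)
    (v : ℕ) (hv : 2 ≤ v) (hvk : v ≤ Module.finrank K A.code) :
    (A.n : ℤ) - A.t * A.ell * (A.r + 1) - ((A.r : ℤ) - 1) * A.h
        + (AGCode.gonality K F (v - 1) : ℤ)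
      ≤ (AGCode.genHammingWeight A.code v : ℤ) := by
  exact A.le_genHammingWeight hE hF (by omega) hvk
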